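/- **Setting.** For $x,y\in\mathbb R^n$ let $x\odot y$ be the coordinatewise product, $x\oplus y=\mathbf 1-(\mathbf 1-x)\odot(\mathbf 1-y)$, and let $x\vee y$, $x\wedge y$ be the coordinatewise maximum and minimum. Let $\gamma\in(0,1]$, $t_s\in(0,1)$, $\varepsilon\in(0,1/2)$, $\delta\in(0,1)$. Let $F:[0,1]^n\to\mathbb R_{\ge0}$ be differentiable and * $L$-smooth: $\|\nabla F(x)-\nabla F(y)\|_2\le L\|x-y\|_2$ for all $x,y\in[0,1]^n$; * $\gamma$-weakly DR-submodular: $F(x+ce_i)-F(x)\ge\gamma\,(F(y+ce_i)-F(y))$ whenever $x\le y$, $c>0$ and $x,\,y,\,x+ce_i,\,y+ce_i\in[0,1]^n$. Let $P\subseteq[0,1]^n$ be a down-closed convex body (compact, convex, with nonempty interior, and $0\le x\le y\in P$ implies $x\in P$) of Euclidean diameter $D$. Let $z\in P$, and let $o\in P$ be a maximizer of $F$ over $P$. **The algorithm $\gamma$-FWG.** Let $m=\lceil 1/\min\{\delta,\varepsilon\}\rceil$, $\bar\delta=1/m$, $i_s=\lceil t_s/\bar\delta\rceil$ and $\beta=\frac{\gamma^2\bar\delta}{1-\bar\delta+\gamma^2\bar\delta}$.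 The algorithm is given surrogates $g,g_\odot,g_\oplus$ with $$(1-\varepsilon)F(o)\le g\le F(o),\qquad F(z\odot o)-\varepsilon g\le g_\odot\le F(z\odot o),\qquad F(z\oplus o)-\varepsilon g\le g_\oplus\le F(z\oplus o).$$ For $0\le i<i_s$ put $z(i)=z$ and $$v(i)=\Bigl[(1-\beta)^i+\tfrac{1-(1-\beta)^i-2\varepsilon}{\gamma}\Bigr]g-\tfrac1\gamma g_\odot-\tfrac{1-(1-\beta)^i}{\gamma}g_\oplus .$$ For $i\ge i_s$ put $z(i)=\mathbf 0$ and $$v(i)=(1-\beta)^i\Bigl[\Bigl(\tfrac{(1-\beta)^{-i_s}}{\gamma}-\bigl(1+\tfrac3\gamma\bigr)\varepsilon+1-\tfrac1\gamma\Bigr)g-\Bigl(\tfrac{(1-\beta)^{-i_s}}{\gamma}-\tfrac1\gamma-\beta(i-i_s)\Bigr)g_\oplus\Bigr].$$ Start with $y(0)=\mathbf 0$. For $i=1,\dots,m$ let $w(i)=(\mathbf 1-y(i-1)-z(i-1))\odot\nabla F(y(i-1))$ and $$Q(i)=\{x\in P:\langle w(i),x\rangle\ge\gamma\,(v(i-1)-F(y(i-1)))\}.$$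 If $Q(i)=\varnothing$, let $x(i)\in P$ be arbitrary. Otherwise let $x(i)$ be an output of the following Frank–Wolfe variant on $Q(i)$: start at an arbitrary $u_0\in Q(i)$; for $0\le k<m^2$ choose $s_k\in\arg\max_{s\in Q(i)}\langle s,\nabla F(u_k)\rangle$ and set $u_{k+1}=(1-\bar\delta)u_k+\bar\delta s_k$; return a $u_k$ with $0\le k<m^2$ minimizing $\langle s_k-u_k,\nabla F(u_k)\rangle$. Then set $y(i)=y(i-1)+\bar\delta\,(\mathbf 1-y(i-1)-z(i-1))\odot x(i)$. The output is $y=y(m)$ together with $x(1),\dots,x(m)$. **Theorem.** There are absolute constants $C,K>0$ such that the following holds for all data as above. We have $m\le K(\delta^{-1}+\varepsilon^{-1})$, the algorithm has at least one execution, and for every execution $y\in P$, $x(1),\dots,x(m)\in P$, and at least one of the following holds. 1. $F(y)\ge(A_\gamma(t_s)-C\varepsilon)\,F(o)+B_\gamma(t_s)\,F(z\odot o)+C_\gamma(t_s)\,F(z\oplus o)-\delta LD^2$. 2. There is $i\in\{1,\dots,m\}$ such that $F(x(i)\oplus o)\le F(z\oplus o)-\varepsilon F(o)$, the maximum of $F$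 over $Q(i)$ exists, and $$F(x(i))\ge\frac{\gamma^2F(x(i)\vee o)+F(x(i)\wedge o)}{1+\gamma^2}-\frac{\delta\gamma}{1+\gamma^2}\Bigl(\max_{y'\in Q(i)}F(y')+\tfrac12LD^2\Bigr).$$ Here $$A_\gamma(t)=-\frac{e^{\gamma t-\gamma}}{1-\gamma}+\frac{e^{-\gamma^2}}{\gamma(1-\gamma)}\bigl(e^{\gamma^2t}-(1-\gamma)\bigr),\qquad B_\gamma(t)=\frac{e^{-\gamma}-e^{\gamma t-\gamma}}{\gamma},$$ $$\begin{aligned}C_\gamma(t)={}&\frac{e^{\gamma^2t}-1}{\gamma(1-\gamma)}\bigl(e^{-\gamma(1-t)-\gamma^2t}-e^{-\gamma^2}\bigr)+\frac{e^{-\gamma(1-t)}}{\gamma}\Bigl[(e^{-\gamma t}-1)+\frac{e^{-\gamma^2t}-e^{-\gamma t}}{1-\gamma}\Bigr]\\&+e^{-\gamma(1-t)-\gamma^2t}\Bigl[\frac{\gamma^2}{1-\gamma}(1-t)e^{\gamma(1-\gamma)(1-t)}+\frac{\gamma}{(1-\gamma)^2}\bigl(1-e^{\gamma(1-\gamma)(1-t)}\bigr)\Bigr],\end{aligned}$$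 and at $\gamma=1$ the coefficients are the limits of these expressions: $A_1(t)=e^{t-1}(2-t)-e^{-1}$, $B_1(t)=e^{-1}-e^{t-1}$, and $C_1(t)=e^{-1}\bigl(2+\tfrac{(1-t)^2}{2}\bigr)-e^{t-1}(2-t)$. -/

import Mathlib

open Filter Topology

namespace GammaFWG

noncomputable section

/-! ### Vectors in `ℝⁿ` with the Euclidean norm -/

/-- `ℝⁿ` with the standard inner product and the Euclidean norm. -/
abbrev Vec (n : ℕ) : Type := EuclideanSpace ℝ (Fin n)

/-- The all-ones vector. -/
def ones (n : ℕ) : Vec n := WithLp.toLp 2 fun _ => 1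

/-- The coordinatewise (Hadamard) product `x ⊙ y`. -/
def had {n : ℕ} (x y : Vec n) : Vec n := WithLp.toLp 2 fun i => x i * y i

/-- The probabilistic sum `x ⊕ y = 1 - (1 - x) ⊙ (1 - y)`. -/
def psum {n : ℕ} (x y : Vec n) : Vec n := ones n - had (ones n - x) (ones n - y)

/-- The coordinatewise maximum `x ∨ y`. -/
def vjoin {n : ℕ} (x y : Vec n) : Vec n := WithLp.toLp 2 fun i => max (x i) (y i)

/-- The coordinatewise minimum `x ∧ y`. -/
def vmeet {n : ℕ} (x y : Vec n) : Vec n := WithLp.toLp 2 fun i => min (x i) (y i)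

/-- The cube `[0,1]ⁿ`. -/
def cube (n : ℕ) : Set (Vec n) := {x | ∀ i, 0 ≤ x i ∧ x i ≤ 1}

/-! ### Functions on the cube and feasible sets

A function `[0,1]ⁿ → ℝ` is represented by a function on `ℝⁿ` of which only the values on the cube
are ever used. -/

/-- The gradient of `F : [0,1]ⁿ → ℝ` (one-sided at the boundary of the cube). -/
def grad {n : ℕ} (F : Vec n → ℝ) (x : Vec n) : Vec n := gradientWithin F (cube n) x

/-- `F` is `γ`-weakly DR-submodular on the cube. -/
def IsWeaklyDR {n : ℕ} (γ : ℝ) (F : Vec n → ℝ) : Prop :=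
  ∀ x ∈ cube n, ∀ y ∈ cube n, (∀ j, x j ≤ y j) →
    ∀ (i : Fin n) (c : ℝ), 0 < c →
      x + EuclideanSpace.single i c ∈ cube n → y + EuclideanSpace.single i c ∈ cube n →
        γ * (F (y + EuclideanSpace.single i c) - F y) ≤ F (x + EuclideanSpace.single i c) - F x

/-- `F` is differentiable on the cube and its gradient is `L`-Lipschitz there. -/
def IsSmooth {n : ℕ} (L : ℝ) (F : Vec n → ℝ) : Prop :=
  DifferentiableOn ℝ F (cube n) ∧
    ∀ x ∈ cube n, ∀ y ∈ cube n, ‖grad F x - grad F y‖ ≤ L * ‖x - y‖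

/-- `P` is a down-closed convex body contained in the cube. -/
structure IsDownClosedBody {n : ℕ} (P : Set (Vec n)) : Prop where
  subset_cube : P ⊆ cube n
  convex : Convex ℝ P
  compact : IsCompact P
  interior_nonempty : (interior P).Nonempty
  down_closed : ∀ y ∈ P, ∀ x : Vec n, (∀ i, 0 ≤ x i ∧ x i ≤ y i) → x ∈ P

/-! ### The Frank-Wolfe subroutine -/

/-- `x` is a possible output of the Frank-Wolfe variant for maximizing `F` over `Q`, run for `m²`
iterations with step size `1 / m`: start from an arbitrary point of `Q`; in iteration `k` let
`s k ∈ Q` maximize the linear function `⟨·, ∇F(u k)⟩` over `Q` and move to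
`u (k + 1) = (1 - 1/m) u k + (1/m) s k`; return the iterate `u k` with the smallest value of
`⟨s k - u k, ∇F(u k)⟩`. -/
def IsFrankWolfeOutput {n : ℕ} (F : Vec n → ℝ) (Q : Set (Vec n)) (m : ℕ) (x : Vec n) : Prop :=
  ∃ u s : ℕ → Vec n,
    u 0 ∈ Q ∧
    (∀ k < m ^ 2,
      s k ∈ Q ∧ IsMaxOn (fun v => inner ℝ v (grad F (u k))) Q (s k) ∧
      u (k + 1) = (1 - 1 / (m : ℝ)) • u k + (1 / (m : ℝ)) • s k) ∧
    ∃ k < m ^ 2,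
      (∀ l < m ^ 2,
        inner ℝ (s k - u k) (grad F (u k)) ≤ inner ℝ (s l - u l) (grad F (u l))) ∧
      x = u k

/-! ### The algorithm `γ`-FWG -/

/-- The numerical data of a run of `γ`-FWG: the parameters `γ, t_s, ε, δ` and the surrogates
`g, g_⊙, g_⊕` for the values `F(o), F(z ⊙ o), F(z ⊕ o)`. -/
structure Params where
  γ : ℝ
  tS : ℝ
  ε : ℝ
  δ : ℝ
  g : ℝ
  gOdot : ℝ
  gOplus : ℝ

namespace Params

/-- The number of iterations `m = ⌈1 / min{δ, ε}⌉`. -/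
def m (p : Params) : ℕ := ⌈1 / min p.δ p.ε⌉₊

/-- The step size `1 / m`, i.e. `δ` after the reduction that makes its inverse an integer and makes
it at most `ε` (it equals `δ` if `δ` already has these properties). -/
def step (p : Params) : ℝ := 1 / (p.m : ℝ)

/-- The switching index `i_s = ⌈t_s / step⌉`. -/
def iS (p : Params) : ℕ := ⌈p.tS / p.step⌉₊

/-- `β = γ² step / (1 - step + γ² step)`. -/
def β (p : Params) : ℝ := p.γ ^ 2 * p.step / (1 - p.step + p.γ ^ 2 * p.step)

/-- The threshold used before the switch. -/
def v₁ (p : Params) (i : ℕ) : ℝ :=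
  ((1 - p.β) ^ i + (1 - (1 - p.β) ^ i - 2 * p.ε) / p.γ) * p.g
    - 1 / p.γ * p.gOdot - (1 - (1 - p.β) ^ i) / p.γ * p.gOplus

/-- The threshold used after the switch. -/
def v₂ (p : Params) (i : ℕ) : ℝ :=
  (1 - p.β) ^ i *
    ((((1 - p.β) ^ p.iS)⁻¹ / p.γ - (1 + 3 / p.γ) * p.ε + 1 - 1 / p.γ) * p.g
      - (((1 - p.β) ^ p.iS)⁻¹ / p.γ - 1 / p.γ - p.β * ((i : ℝ) - (p.iS : ℝ))) * p.gOplus)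

/-- The threshold `v(i)`. -/
def v (p : Params) (i : ℕ) : ℝ := if i < p.iS then p.v₁ i else p.v₂ i

/-- The vector `z(i)`: the seed `z` before the switch and `0` afterwards. -/
def seed {n : ℕ} (p : Params) (z : Vec n) (i : ℕ) : Vec n := if i < p.iS then z else 0

/-- The vector `w = (1 - y - z(i)) ⊙ ∇F(y)`. -/
def weight {n : ℕ} (p : Params) (F : Vec n → ℝ) (z : Vec n) (i : ℕ) (y : Vec n) : Vec n :=
  had (ones n - y - p.seed z i) (grad F y)

/-- The set `{x ∈ P | ⟨w, x⟩ ≥ γ (v(i) - F(y))}`; with `y = y(i)` this is `Q(i + 1)`. -/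
def Q {n : ℕ} (p : Params) (F : Vec n → ℝ) (P : Set (Vec n)) (z : Vec n) (i : ℕ) (y : Vec n) :
    Set (Vec n) :=
  {x | x ∈ P ∧ p.γ * (p.v i - F y) ≤ inner ℝ (p.weight F z i y) x}

/-- `x(1), …, x(m)` and `y(0), …, y(m)` are the vectors produced by a run of `γ`-FWG on `F`, `P` and
the seed `z`. In iteration `i + 1`, the vector `x(i + 1)` is an output of the Frank-Wolfe subroutine
on `Q(i + 1)`, or an arbitrary point of `P` if `Q(i + 1)` is empty. -/
structure IsRun {n : ℕ} (p : Params) (F : Vec n → ℝ) (P : Set (Vec n)) (z : Vec n)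
    (x y : ℕ → Vec n) : Prop where
  init : y 0 = 0
  choose_x : ∀ i < p.m, (p.Q F P z i (y i)).Nonempty →
    IsFrankWolfeOutput F (p.Q F P z i (y i)) p.m (x (i + 1))
  arbitrary_x : ∀ i < p.m, ¬ (p.Q F P z i (y i)).Nonempty → x (i + 1) ∈ P
  update_y : ∀ i < p.m,
    y (i + 1) = y i + p.step • had (ones n - y i - p.seed z i) (x (i + 1))

/-- The surrogates `g, g_⊙, g_⊕` are valid for the comparator `o` and the seed `z`. -/
structure ValidSurrogates {n : ℕ} (p : Params) (F : Vec n → ℝ) (z o : Vec n) : Prop where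
  g_lower : (1 - p.ε) * F o ≤ p.g
  g_upper : p.g ≤ F o
  gOdot_lower : F (had z o) - p.ε * p.g ≤ p.gOdot
  gOdot_upper : p.gOdot ≤ F (had z o)
  gOplus_lower : F (psum z o) - p.ε * p.g ≤ p.gOplus
  gOplus_upper : p.gOplus ≤ F (psum z o)

end Params

/-! ### The coefficients

For `γ < 1` they are given by closed formulas; at `γ = 1`, where these have a factor `1 - γ` in the
denominator, by the limits of the formulas (computed below). -/

/-- `A_γ(t)` for `γ < 1`, without the `O(ε)` term. -/
def formulaA (γ t : ℝ) : ℝ :=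
  -(Real.exp (γ * t - γ) / (1 - γ))
    + Real.exp (-γ ^ 2) / (γ * (1 - γ)) * (Real.exp (γ ^ 2 * t) - (1 - γ))

/-- `B_γ(t)`. -/
def coefB (γ t : ℝ) : ℝ := (Real.exp (-γ) - Real.exp (γ * t - γ)) / γ

/-- `C_γ(t)` for `γ < 1`. -/
def formulaC (γ t : ℝ) : ℝ :=
  (Real.exp (γ ^ 2 * t) - 1) / (γ * (1 - γ))
      * (Real.exp (-γ * (1 - t) - γ ^ 2 * t) - Real.exp (-γ ^ 2))
    + Real.exp (-γ * (1 - t)) / γ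
      * ((Real.exp (-γ * t) - 1) + (Real.exp (-γ ^ 2 * t) - Real.exp (-γ * t)) / (1 - γ))
    + Real.exp (-γ * (1 - t) - γ ^ 2 * t)
      * (γ ^ 2 / (1 - γ) * (1 - t) * Real.exp (γ * (1 - γ) * (1 - t))
        + γ / (1 - γ) ^ 2 * (1 - Real.exp (γ * (1 - γ) * (1 - t))))

/-- `A_γ(t)` for `0 < γ ≤ 1`, without the `O(ε)` term. -/
def coefA (γ t : ℝ) : ℝ :=
  if γ = 1 then Real.exp (t - 1) * (2 - t) - Real.exp (-1) else formulaA γ t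

/-- `C_γ(t)` for `0 < γ ≤ 1`. -/
def coefC (γ t : ℝ) : ℝ :=
  if γ = 1 then Real.exp (-1) * (2 + (1 - t) ^ 2 / 2) - Real.exp (t - 1) * (2 - t)
  else formulaC γ t

/-- The value of `coefA` at `γ = 1` is the limit of the formula for `γ ≠ 1`. -/
theorem tendsto_formulaA (t : ℝ) :
    Tendsto (fun γ => formulaA γ t) (𝓝[≠] 1) (𝓝 (coefA 1 t)) := by
  have hd : HasDerivAt (fun x : ℝ => Real.exp (-x ^ 2) * Real.exp (x ^ 2 * t)
      - x * Real.exp (x * t - x)) (-(Real.exp (t - 1) * (2 - t))) 1 := by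
    have h1 := (((hasDerivAt_id (1 : ℝ)).pow 2).neg.exp).mul
      ((((hasDerivAt_id (1 : ℝ)).pow 2).mul_const t).exp)
    have h2 := (hasDerivAt_id (1 : ℝ)).mul
      ((((hasDerivAt_id (1 : ℝ)).mul_const t).sub (hasDerivAt_id (1 : ℝ))).exp)
    refine (h1.sub h2).congr_deriv ?_
    simp only [id, Pi.sub_apply, Pi.pow_apply, Pi.neg_apply, one_pow, one_mul]
    rw [show t - 1 = -1 + t by ring, Real.exp_add]
    push_cast
    ring
  have hs := hasDerivAt_iff_tendsto_slope.1 hd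
  have hc : Tendsto (fun x : ℝ => -(1 / x)) (𝓝[≠] 1) (𝓝 (-(1 / 1))) :=
    ((continuousAt_const.div continuousAt_id one_ne_zero).neg).tendsto.mono_left nhdsWithin_le_nhds
  have he : Tendsto (fun x : ℝ => Real.exp (-x ^ 2) / x) (𝓝[≠] 1) (𝓝 (Real.exp (-1 ^ 2) / 1)) := by
    have : ContinuousAt (fun x : ℝ => Real.exp (-x ^ 2) / x) 1 :=
      (Real.continuous_exp.comp (by fun_prop)).continuousAt.div continuousAt_id one_ne_zero
    exact this.tendsto.mono_left nhdsWithin_le_nhds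
  have hall := (hc.mul hs).sub he
  have hlim : coefA 1 t = -(1 / 1) * -(Real.exp (t - 1) * (2 - t)) - Real.exp (-1 ^ 2) / 1 := by
    simp [coefA]
  rw [hlim]
  refine hall.congr' ?_
  have h0 : ∀ᶠ x : ℝ in 𝓝[≠] 1, x ≠ 0 :=
    eventually_nhdsWithin_of_eventually_nhds (eventually_ne_nhds one_ne_zero)
  filter_upwards [h0, self_mem_nhdsWithin] with x hx0 hx1
  have hx1' : 1 - x ≠ 0 := sub_ne_zero.2 (Ne.symm hx1)
  have hx1'' : x - 1 ≠ 0 := sub_ne_zero.2 hx1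
  have hf1 : Real.exp (-(1 : ℝ) ^ 2) * Real.exp (1 ^ 2 * t) - 1 * Real.exp (1 * t - 1) = 0 := by
    rw [← Real.exp_add]
    ring_nf
  rw [slope_def_field, hf1, formulaA, show x - 1 = -(1 - x) by ring]
  field_simp
  ring

/-- The value of `coefC` at `γ = 1` is the limit of the formula for `γ ≠ 1`. -/
theorem tendsto_formulaC (t : ℝ) (ht : t < 1) :
    Tendsto (fun γ => formulaC γ t) (𝓝[≠] 1) (𝓝 (coefC 1 t)) := by
  have hcont : ∀ f : ℝ → ℝ, ContinuousAt f 1 → Tendsto f (𝓝[≠] 1) (𝓝 (f 1)) :=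
    fun f hf => hf.tendsto.mono_left nhdsWithin_le_nhds
  have hd1 : HasDerivAt (fun x : ℝ => Real.exp (-x * (1 - t) - x ^ 2 * t) - Real.exp (-x ^ 2))
      (Real.exp (-1) * (1 - t)) 1 := by
    have h1 := (((hasDerivAt_id (1 : ℝ)).neg.mul_const (1 - t)).sub
      (((hasDerivAt_id (1 : ℝ)).pow 2).mul_const t)).exp
    have h2 := ((hasDerivAt_id (1 : ℝ)).pow 2).neg.exp
    refine (h1.sub h2).congr_deriv ?_
    simp only [id, Pi.sub_apply, Pi.pow_apply, Pi.neg_apply, one_pow, one_mul]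
    rw [show -1 * (1 - t) - t = (-1 : ℝ) by ring]
    push_cast
    ring
  have hd2 : HasDerivAt (fun x : ℝ => Real.exp (-x ^ 2 * t) - Real.exp (-x * t))
      (-(t * Real.exp (-t))) 1 := by
    have h1 := (((hasDerivAt_id (1 : ℝ)).pow 2).neg.mul_const t).exp
    have h2 := ((hasDerivAt_id (1 : ℝ)).neg.mul_const t).exp
    refine (h1.sub h2).congr_deriv ?_
    simp only [id, Pi.pow_apply, Pi.neg_apply, one_pow]
    rw [show -1 * t = -t by ring]
    push_cast
    ring
  have hψ : Tendsto (fun w : ℝ => (w * Real.exp w + 1 - Real.exp w) / w ^ 2) (𝓝[≠] 0)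
      (𝓝 (1 / 2)) := by
    refine HasDerivAt.lhopital_zero_nhdsNE (f' := fun w => w * Real.exp w) (g' := fun w => 2 * w)
      ?_ ?_ ?_ ?_ ?_ ?_
    · refine Eventually.of_forall fun w => ?_
      have := (((hasDerivAt_id w).mul (Real.hasDerivAt_exp w)).add_const 1).sub
        (Real.hasDerivAt_exp w)
      refine this.congr_deriv ?_
      simp
    · refine Eventually.of_forall fun w => ?_
      simpa using hasDerivAt_pow 2 w
    · filter_upwards [self_mem_nhdsWithin] with w hw
      exact mul_ne_zero two_ne_zero hw
    · have : Tendsto (fun w : ℝ => w * Real.exp w + 1 - Real.exp w) (𝓝 0)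
          (𝓝 (0 * Real.exp 0 + 1 - Real.exp 0)) := by
        apply Continuous.tendsto; fun_prop
      simpa using this.mono_left nhdsWithin_le_nhds
    · have : Tendsto (fun w : ℝ => w ^ 2) (𝓝 0) (𝓝 (0 ^ 2)) := by
        apply Continuous.tendsto; fun_prop
      simpa using this.mono_left nhdsWithin_le_nhds
    · have : Tendsto (fun w : ℝ => Real.exp w / 2) (𝓝 0) (𝓝 (Real.exp 0 / 2)) := by
        apply Continuous.tendsto; fun_prop
      rw [Real.exp_zero] at this
      refine (this.mono_left nhdsWithin_le_nhds).congr' ?_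
      filter_upwards [self_mem_nhdsWithin] with w hw
      have hw0 : w ≠ 0 := hw
      field_simp
  have hs0 : 1 - t ≠ 0 := by linarith
  have h0 : ∀ᶠ x : ℝ in 𝓝[≠] 1, x ≠ 0 :=
    eventually_nhdsWithin_of_eventually_nhds (eventually_ne_nhds one_ne_zero)
  have hw : Tendsto (fun x : ℝ => x * (1 - x) * (1 - t)) (𝓝[≠] 1) (𝓝[≠] 0) := by
    refine tendsto_nhdsWithin_iff.2 ⟨?_, ?_⟩
    · have := hcont (fun x : ℝ => x * (1 - x) * (1 - t)) (by fun_prop)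
      simpa using this
    · filter_upwards [h0, self_mem_nhdsWithin] with x hx0 hx1
      exact mul_ne_zero (mul_ne_zero hx0 (sub_ne_zero.2 (Ne.symm hx1))) hs0
  have hψ' := hψ.comp hw
  have hs1 := hasDerivAt_iff_tendsto_slope.1 hd1
  have hs2 := hasDerivAt_iff_tendsto_slope.1 hd2
  have c1 := hcont (fun x : ℝ => -((Real.exp (x ^ 2 * t) - 1) / x))
    (by apply ContinuousAt.neg; apply ContinuousAt.div <;> first | fun_prop | exact one_ne_zero)
  have c2 := hcont (fun x : ℝ => Real.exp (-x * (1 - t)) / x)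
    (by apply ContinuousAt.div <;> first | fun_prop | exact one_ne_zero)
  have c3 := hcont (fun x : ℝ => Real.exp (-x * t) - 1) (by fun_prop)
  have c4 := hcont (fun x : ℝ => Real.exp (-x * (1 - t) - x ^ 2 * t) * (x ^ 3 * (1 - t) ^ 2))
    (by fun_prop)
  have hall := ((c1.mul hs1).add (c2.mul (c3.sub hs2))).add (c4.mul hψ')
  have hlim : coefC 1 t = -((Real.exp (1 ^ 2 * t) - 1) / 1) * (Real.exp (-1) * (1 - t))
      + Real.exp (-1 * (1 - t)) / 1 * (Real.exp (-1 * t) - 1 - -(t * Real.exp (-t)))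
      + Real.exp (-1 * (1 - t) - 1 ^ 2 * t) * (1 ^ 3 * (1 - t) ^ 2) * (1 / 2) := by
    have e1 : Real.exp (t - 1) = Real.exp t * Real.exp (-1) := by
      rw [← Real.exp_add]; ring_nf
    have e2 : Real.exp (-1 * (1 - t)) = Real.exp t * Real.exp (-1) := by
      rw [← Real.exp_add]; ring_nf
    have e3 : Real.exp (-1 * (1 - t) - 1 ^ 2 * t) = Real.exp (-1) := by ring_nf
    have e4 : Real.exp (-1 * t) = Real.exp (-t) := by ring_nf
    have e5 : Real.exp t * Real.exp (-t) = 1 := by rw [← Real.exp_add]; simp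
    rw [e2, e3, e4]
    simp only [coefC, if_true, e1, one_pow, one_mul, div_one]
    linear_combination (-(Real.exp (-1)) * (1 + t)) * e5
  rw [hlim]
  refine hall.congr' ?_
  filter_upwards [h0, self_mem_nhdsWithin] with x hx0 hx1
  have hx1' : 1 - x ≠ 0 := sub_ne_zero.2 (Ne.symm hx1)
  have f1 : Real.exp (-(1 : ℝ) * (1 - t) - 1 ^ 2 * t) - Real.exp (-1 ^ 2) = 0 := by
    ring_nf
  have f2 : Real.exp (-(1 : ℝ) ^ 2 * t) - Real.exp (-1 * t) = 0 := by
    ring_nf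
  rw [slope_def_field, slope_def_field, f1, f2, formulaC, show x - 1 = -(1 - x) by ring]
  simp only [Function.comp_apply]
  field_simp
  ring

end

end GammaFWG

open GammaFWG

/-! Write h = 1/m and b = 1 - β. If o belongs to every Q(i+1), no such set is empty, so the linear
constraint defining it together with smoothness gives F(y(i+1)) ≥ (1 - hγ) F(y(i)) + hγ v(i) -
h²LD²/2. Unrolled, F(y(m)) is at least the sum of h (1 - hγ)^(m-1-i) γ v(i), up to hLD²/2. Once the
thresholds are inserted, this is a discretization of three integrals whose values are A, B and C,
and the O(h) error is O(ε) because h ≤ ε.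

The substance is therefore the feasibility of o. Weak DR-submodularity bounds ⟨w, o⟩ from below by
γ(F(y + (1-y-z)⊙o) - F(y)), so it suffices that v(i) ≤ F(y + (1-y-z)⊙o). Before the switch the right
side is at least F(y⊕o) - F(z⊙o)/γ, and y ≤ (1 - (1-h)^i)(1-z) keeps F(y⊕o) large
(`IsWeaklyDR.psum_lower_of_disjoint`). After the switch y(i+1)⊕o lies on the segment from y(i)⊕o to
y(i)⊕(x(i+1)⊕o), and F there is at least b times the old value plus β times the value at the far end
(`IsWeaklyDR.psum_step`). So o remains feasible as long as F(x(i+1)⊕o) ≥ F(z⊕o) - εF(o)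
(`IsRun.mem_Q`).

If this bound fails at some i with o ∈ Q(i+1), then o is a competitor of the Frank-Wolfe subroutine
there. Its small gap makes x(i+1) nearly stationary in the direction of o, and passing through the
join and the meet gives the second alternative.

Two devices recur: the interpolation inequality `IsWeaklyDR.interpolate`, from which β comes, and
the dichotomy that F is monotone unless γ = 1 (`IsWeaklyDR.monotone_or`). -/

namespace GammaFWG

/-! ### Coordinates and the cube -/

@[simp] lemma ones_apply {n : ℕ} (i : Fin n) : ones n i = 1 := rfl

@[simp] lemma had_apply {n : ℕ} (x y : Vec n) (i : Fin n) : had x y i = x i * y i := rfl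

@[simp] lemma psum_apply {n : ℕ} (x y : Vec n) (i : Fin n) :
    psum x y i = 1 - (1 - x i) * (1 - y i) := rfl

@[simp] lemma vjoin_apply {n : ℕ} (x y : Vec n) (i : Fin n) : vjoin x y i = max (x i) (y i) := rfl

@[simp] lemma vmeet_apply {n : ℕ} (x y : Vec n) (i : Fin n) : vmeet x y i = min (x i) (y i) := rfl

lemma convex_cube (n : ℕ) : Convex ℝ (cube n) := by
  intro x hx y hy a b ha hb hab i
  have h1 := hx i
  have h2 := hy i
  simp only [PiLp.add_apply, PiLp.smul_apply, smul_eq_mul]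
  constructor
  · nlinarith [mul_nonneg ha h1.1, mul_nonneg hb h2.1]
  · nlinarith [mul_nonneg ha (sub_nonneg.2 h1.2), mul_nonneg hb (sub_nonneg.2 h2.2)]

lemma zero_mem_cube (n : ℕ) : (0 : Vec n) ∈ cube n := fun _ => by simp

lemma psum_mem_cube {n : ℕ} {x y : Vec n} (hx : x ∈ cube n) (hy : y ∈ cube n) :
    psum x y ∈ cube n := by
  intro i
  have h1 := hx i
  have h2 := hy i
  simp only [psum_apply]
  constructor
  · nlinarith [mul_nonneg h1.1 (sub_nonneg.2 h2.2)]
  · nlinarith [mul_nonneg (sub_nonneg.2 h1.2) (sub_nonneg.2 h2.2)]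

lemma had_mem_cube {n : ℕ} {x y : Vec n} (hx : x ∈ cube n) (hy : y ∈ cube n) :
    had x y ∈ cube n := by
  intro i
  have h1 := hx i
  have h2 := hy i
  simp only [had_apply]
  exact ⟨mul_nonneg h1.1 h2.1, mul_le_one₀ h1.2 h2.1 h2.2⟩

lemma add_smul_mem_cube {n : ℕ} {x d : Vec n} (hx : x ∈ cube n) (hxd : x + d ∈ cube n)
    {t : ℝ} (ht0 : 0 ≤ t) (ht1 : t ≤ 1) : x + t • d ∈ cube n :=
  (convex_cube n).add_smul_mem hx hxd ⟨ht0, ht1⟩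

lemma norm_had_le {n : ℕ} {a x : Vec n} (ha : a ∈ cube n) : ‖had a x‖ ≤ ‖x‖ := by
  rw [EuclideanSpace.norm_eq, EuclideanSpace.norm_eq]
  refine Real.sqrt_le_sqrt (Finset.sum_le_sum fun i _ => ?_)
  have h := ha i
  simp only [had_apply, norm_mul, mul_pow, Real.norm_eq_abs, sq_abs]
  have : a i ^ 2 ≤ 1 := by nlinarith
  nlinarith [sq_nonneg (x i)]

lemma inner_had_left {n : ℕ} (a b c : Vec n) : inner ℝ (had a b) c = inner ℝ (had a c) b := by
  simp only [PiLp.inner_apply, had_apply]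
  refine Finset.sum_congr rfl fun i _ => ?_
  simp
  ring

/-! ### Increments of weakly DR-submodular functions -/

/-- Removes the coordinates outside `S`. -/
def restrictCoords {n : ℕ} (S : Finset (Fin n)) (d : Vec n) : Vec n :=
  WithLp.toLp 2 fun j => if j ∈ S then d j else 0

/-- The coordinates of d are added one at a time and both increments telescope; adding the same
partial direction to x and y preserves their order. -/
lemma IsWeaklyDR.increment_le {n : ℕ} {γ : ℝ} {F : Vec n → ℝ} (hF : IsWeaklyDR γ F)
    {x y d : Vec n} (hx : x ∈ cube n) (hxy : ∀ j, x j ≤ y j) (hd : ∀ j, 0 ≤ d j)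
    (hyd : y + d ∈ cube n) : γ * (F (y + d) - F y) ≤ F (x + d) - F x := by
  have key : ∀ S : Finset (Fin n), γ * (F (y + restrictCoords S d) - F y)
      ≤ F (x + restrictCoords S d) - F x := by
    intro S
    induction S using Finset.induction_on with
    | empty =>
      have : restrictCoords ∅ d = 0 := by ext j; simp [restrictCoords]
      simp [this]
    | insert a S ha ih =>
      have he : restrictCoords (insert a S) d
          = restrictCoords S d + EuclideanSpace.single a (d a) := by
        ext j
        by_cases hj : j = a
        · subst hj; simp [restrictCoords, ha]
        · simp [restrictCoords, hj]
      have hmem : ∀ (T : Finset (Fin n)) (w : Vec n), w ∈ cube n → (∀ j, w j ≤ y j) →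
          w + restrictCoords T d ∈ cube n := by
        intro T w hw hwy j
        have h1 := hw j
        have h2 := hwy j
        have h3 := hyd j
        have h4 := hd j
        simp only [restrictCoords, PiLp.add_apply] at h3 ⊢
        split_ifs <;> constructor <;> linarith
      have hyc : y ∈ cube n := fun j => by
        have h1 := hyd j
        have h2 := hd j
        have h3 := hxy j
        have h4 := hx j
        simp only [PiLp.add_apply] at h1
        constructor <;> linarith
      -- Weak DR-submodularity speaks only of c > 0, so vanishing coordinates are skipped.
      rcases (hd a).eq_or_lt with h0 | h0
      · have : restrictCoords (insert a S) d = restrictCoords S d := by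
          rw [he, ← h0]; simp
        rw [this]; exact ih
      · have := hF (x + restrictCoords S d) (hmem S x hx hxy) (y + restrictCoords S d)
          (hmem S y hyc fun _ => le_rfl)
          (fun j => by simp only [PiLp.add_apply]; linarith [hxy j]) a (d a) h0
          (by rw [add_assoc, ← he]; exact hmem _ x hx hxy)
          (by rw [add_assoc, ← he]; exact hmem _ y hyc fun _ => le_rfl)
        rw [add_assoc, ← he, add_assoc, ← he] at this
        linarith
  have hu : restrictCoords Finset.univ d = d := by ext j; simp [restrictCoords]
  have := key Finset.univ
  rwa [hu] at this

/-- With both base points equal, the inequality reads γΔ ≤ Δ for an increment Δ, which forces Δ ≥ 0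
once γ < 1. -/
lemma IsWeaklyDR.monotone_or {n : ℕ} {γ : ℝ} {F : Vec n → ℝ} (hF : IsWeaklyDR γ F) (h1 : γ ≤ 1) :
    γ = 1 ∨ ∀ x ∈ cube n, ∀ y ∈ cube n, (∀ j, x j ≤ y j) → F x ≤ F y := by
  rcases h1.eq_or_lt with h | h
  · exact Or.inl h
  · refine Or.inr fun x hx y hy hxy => ?_
    have := hF.increment_le (d := y - x) hx (fun _ => le_rfl)
      (fun j => by simpa using hxy j) (by simpa using hy)
    rw [add_sub_cancel] at this
    nlinarith

/-! ### Derivatives along segments -/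

lemma hasDerivWithinAt_segment {n : ℕ} {F : Vec n → ℝ} (hF : DifferentiableOn ℝ F (cube n))
    {x d : Vec n} (hx : x ∈ cube n) (hxd : x + d ∈ cube n) {t : ℝ} (ht : t ∈ Set.Icc (0 : ℝ) 1) :
    HasDerivWithinAt (fun s : ℝ => F (x + s • d)) (inner ℝ (grad F (x + t • d)) d)
      (Set.Icc 0 1) t := by
  have hg := ((hF _ (add_smul_mem_cube hx hxd ht.1 ht.2)).hasGradientWithinAt).hasFDerivWithinAt
  have hl : HasDerivWithinAt (fun s : ℝ => x + s • d) d (Set.Icc 0 1) t := by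
    have := ((hasDerivAt_id t).smul_const d).const_add x
    simpa using this.hasDerivWithinAt
  have := hg.comp_hasDerivWithinAt t hl (fun s hs => add_smul_mem_cube hx hxd hs.1 hs.2)
  simpa [grad, Function.comp_def] using this

lemma tendsto_increment {n : ℕ} {F : Vec n → ℝ} (hF : DifferentiableOn ℝ F (cube n))
    {x d : Vec n} (hx : x ∈ cube n) (hxd : x + d ∈ cube n) :
    Tendsto (fun N : ℕ => ((N : ℝ) + 1) * (F (x + (1 / ((N : ℝ) + 1)) • d) - F x)) atTop
      (𝓝 (inner ℝ d (grad F x))) := by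
  have h := hasDerivWithinAt_segment hF hx hxd (t := 0) ⟨le_rfl, zero_le_one⟩
  rw [hasDerivWithinAt_iff_tendsto_slope] at h
  have hu : Tendsto (fun N : ℕ => 1 / ((N : ℝ) + 1)) atTop (𝓝[Set.Icc 0 1 \ {0}] 0) := by
    refine tendsto_nhdsWithin_iff.2 ⟨tendsto_one_div_add_atTop_nhds_zero_nat,
      Eventually.of_forall fun N => ⟨⟨by positivity, ?_⟩, ?_⟩⟩
    · rw [div_le_one (by positivity)]; linarith [Nat.cast_nonneg (α := ℝ) N]
    · simp only [Set.mem_singleton_iff]; positivity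
  have h2 := h.comp hu
  rw [zero_smul, add_zero, real_inner_comm] at h2
  refine h2.congr fun N => ?_
  simp [slope_def_field, div_eq_mul_inv]
  ring

/-- Cut d into N + 1 equal pieces: γ times the increment over any piece is at most the increment
over the first. Summing, and letting N → ∞, turns the first increment into the directional
derivative. -/
lemma IsWeaklyDR.le_inner_grad {n : ℕ} {γ : ℝ} {F : Vec n → ℝ} (hF : IsWeaklyDR γ F)
    (hd : DifferentiableOn ℝ F (cube n))
    {x d : Vec n} (hx : x ∈ cube n) (hxd : x + d ∈ cube n) (hd0 : ∀ j, 0 ≤ d j) :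
    γ * (F (x + d) - F x) ≤ inner ℝ d (grad F x) := by
  refine ge_of_tendsto (tendsto_increment hd hx hxd) (Eventually.of_forall fun N => ?_)
  set s : ℝ := 1 / ((N : ℝ) + 1) with hs
  have hN : (0 : ℝ) < (N : ℝ) + 1 := by positivity
  have hs0 : 0 ≤ s := by positivity
  have hNs : ((N : ℝ) + 1) * s = 1 := by rw [hs]; field_simp
  have key : ∀ k : ℕ, k ≤ N + 1 →
      γ * (F (x + ((k : ℝ) * s) • d) - F x) ≤ k * (F (x + s • d) - F x) := by
    intro k
    induction k with
    | zero => intro _; simp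
    | succ k ih =>
      intro hk
      have hk' : ((k : ℝ) + 1) * s ≤ 1 := by
        have : (k : ℝ) + 1 ≤ (N : ℝ) + 1 := by exact_mod_cast hk
        exact (mul_le_mul_of_nonneg_right this hs0).trans_eq hNs
      have e : x + ((k : ℝ) * s) • d + s • d = x + (((k + 1 : ℕ) : ℝ) * s) • d := by
        push_cast; module
      have := hF.increment_le (x := x) (y := x + ((k : ℝ) * s) • d) (d := s • d) hx
        (fun j => by
          simp only [PiLp.add_apply, PiLp.smul_apply, smul_eq_mul]
          have := mul_nonneg (mul_nonneg (Nat.cast_nonneg (α := ℝ) k) hs0) (hd0 j)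
          linarith)
        (fun j => by simpa using mul_nonneg hs0 (hd0 j))
        (by
          rw [e]; refine add_smul_mem_cube hx hxd (by positivity) ?_
          push_cast; exact hk')
      rw [e] at this
      have := ih (by omega)
      push_cast at *
      linarith
  have := key (N + 1) le_rfl
  push_cast at this
  rwa [hNs, one_smul] at this

/-- The mirror image: γ times the increment over the piece ending at x is at most the increment over
each piece below it. -/
lemma IsWeaklyDR.inner_grad_le {n : ℕ} {γ : ℝ} {F : Vec n → ℝ} (hF : IsWeaklyDR γ F)
    (hd : DifferentiableOn ℝ F (cube n))
    {x d : Vec n} (hx : x ∈ cube n) (hxd : x - d ∈ cube n) (hd0 : ∀ j, 0 ≤ d j) :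
    γ * inner ℝ d (grad F x) ≤ F x - F (x - d) := by
  have hxd' : x + -d ∈ cube n := by rwa [← sub_eq_add_neg]
  have ht := ((tendsto_increment hd hx hxd').const_mul (-γ))
  rw [inner_neg_left, neg_mul_neg] at ht
  refine le_of_tendsto ht (Eventually.of_forall fun N => ?_)
  set s : ℝ := 1 / ((N : ℝ) + 1) with hs
  have hN : (0 : ℝ) < (N : ℝ) + 1 := by positivity
  have hs0 : 0 ≤ s := by positivity
  have hNs : ((N : ℝ) + 1) * s = 1 := by rw [hs]; field_simp
  have key : ∀ k : ℕ, k ≤ N + 1 →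
      γ * (k * (F x - F (x + s • -d))) ≤ F x - F (x + ((k : ℝ) * s) • -d) := by
    intro k
    induction k with
    | zero => intro _; simp
    | succ k ih =>
      intro hk
      have hk' : ((k : ℝ) + 1) * s ≤ 1 := by
        have : (k : ℝ) + 1 ≤ (N : ℝ) + 1 := by exact_mod_cast hk
        exact (mul_le_mul_of_nonneg_right this hs0).trans_eq hNs
      have e : x + (((k + 1 : ℕ) : ℝ) * s) • -d + s • d = x + ((k : ℝ) * s) • -d := by
        push_cast; module
      have e' : x + s • -d + s • d = x := by module
      have := hF.increment_le (x := x + (((k + 1 : ℕ) : ℝ) * s) • -d) (y := x + s • -d)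
        (d := s • d)
        (add_smul_mem_cube hx hxd' (by positivity) (by push_cast; exact hk'))
        (fun j => by
          simp only [PiLp.add_apply, PiLp.smul_apply, PiLp.neg_apply, smul_eq_mul]
          have := mul_nonneg (mul_nonneg (Nat.cast_nonneg (α := ℝ) k) hs0) (hd0 j)
          push_cast
          linarith)
        (fun j => by simpa using mul_nonneg hs0 (hd0 j))
        (by rwa [e'])
      rw [e, e'] at this
      have := ih (by omega)
      push_cast at *
      linarith
  have := key (N + 1) le_rfl
  push_cast at this
  rw [hNs, one_smul, ← sub_eq_add_neg] at this
  linarith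

/-- Interpolation along a nonnegative direction. -/
lemma IsWeaklyDR.interpolate {n : ℕ} {γ : ℝ} {F : Vec n → ℝ} (hF : IsWeaklyDR γ F)
    (hd : DifferentiableOn ℝ F (cube n)) (hγ0 : 0 < γ)
    {x d : Vec n} (hx : x ∈ cube n) (hxd : x + d ∈ cube n) (hd0 : ∀ j, 0 ≤ d j)
    {c : ℝ} (hc0 : 0 ≤ c) (hc1 : c ≤ 1) :
    (1 - c) * F x + γ ^ 2 * c * F (x + d) ≤ (1 - c + γ ^ 2 * c) * F (x + c • d) := by
  have hm := add_smul_mem_cube hx hxd hc0 hc1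
  have e1 : x + c • d + (1 - c) • d = x + d := by module
  have e2 : x + c • d - c • d = x := by module
  -- Both gradient bounds are taken at the intermediate point, one upward and one downward.
  -- Eliminating the common derivative multiplies the two factors γ, hence γ².
  have h1 := hF.le_inner_grad hd (x := x + c • d) (d := (1 - c) • d) hm (by rwa [e1])
    (fun j => by simpa using mul_nonneg (sub_nonneg.2 hc1) (hd0 j))
  have h2 := hF.inner_grad_le hd (x := x + c • d) (d := c • d) hm (by rwa [e2])
    (fun j => by simpa using mul_nonneg hc0 (hd0 j))
  rw [e1, real_inner_smul_left] at h1
  rw [e2, real_inner_smul_left] at h2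
  have h3 := mul_le_mul_of_nonneg_left h1 (mul_nonneg hγ0.le hc0)
  have h4 := mul_le_mul_of_nonneg_left h2 (sub_nonneg.2 hc1)
  nlinarith

/-- A smooth function is bounded below by its first-order expansion up to a quadratic error. -/
lemma IsSmooth.descent {n : ℕ} {L : ℝ} {F : Vec n → ℝ} (hF : IsSmooth L F)
    {x d : Vec n} (hx : x ∈ cube n) (hxd : x + d ∈ cube n) :
    F x + inner ℝ d (grad F x) - L / 2 * ‖d‖ ^ 2 ≤ F (x + d) := by
  -- The quadratic term makes the first-order remainder monotone in s: at time t the gradient has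
  -- changed by at most Lt‖d‖, and the quadratic contributes the slope tL‖d‖².
  have hder : ∀ t ∈ Set.Icc (0 : ℝ) 1, HasDerivWithinAt
      (fun s : ℝ => F (x + s • d) - s * inner ℝ d (grad F x) + s ^ 2 * (L / 2 * ‖d‖ ^ 2))
      (inner ℝ (grad F (x + t • d)) d - inner ℝ d (grad F x) + 2 * t * (L / 2 * ‖d‖ ^ 2))
      (Set.Icc 0 1) t := by
    intro t ht
    have h1 := hasDerivWithinAt_segment hF.1 hx hxd ht
    have h2 := ((hasDerivAt_id t).mul_const (inner ℝ d (grad F x))).hasDerivWithinAt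
      (s := Set.Icc 0 1)
    have h3 := (((hasDerivAt_pow 2 t)).mul_const (L / 2 * ‖d‖ ^ 2)).hasDerivWithinAt
      (s := Set.Icc 0 1)
    refine ((h1.sub h2).add h3).congr_deriv ?_
    simp
  have hmono := monotoneOn_of_hasDerivWithinAt_nonneg (convex_Icc (0 : ℝ) 1)
    (fun t ht => (hder t ht).continuousWithinAt)
    (fun t ht => (hder t (interior_subset ht)).mono interior_subset)
    (fun t ht => by
      have ht' := interior_subset ht
      have hb := hF.2 _ (add_smul_mem_cube hx hxd ht'.1 ht'.2) x hx
      have hi : |inner ℝ (grad F (x + t • d) - grad F x) d|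
          ≤ ‖grad F (x + t • d) - grad F x‖ * ‖d‖ := abs_real_inner_le_norm _ _
      rw [add_sub_cancel_left, norm_smul, Real.norm_of_nonneg ht'.1] at hb
      rw [inner_sub_left, real_inner_comm d (grad F x)] at hi
      have h1 := (abs_le.1 hi).1
      have h2 := mul_le_mul_of_nonneg_right hb (norm_nonneg d)
      rw [real_inner_comm (grad F x) d] at h1
      rw [real_inner_comm (grad F x) d]
      nlinarith)
  have := hmono (a := 0) (b := 1) ⟨le_rfl, zero_le_one⟩ ⟨zero_le_one, le_rfl⟩ zero_le_one
  simp only [zero_smul, one_smul, add_zero] at this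
  linarith

/-! ### Down-closed bodies -/

lemma IsDownClosedBody.zero_mem {n : ℕ} {P : Set (Vec n)} (hP : IsDownClosedBody P) {o : Vec n}
    (ho : o ∈ P) : (0 : Vec n) ∈ P :=
  hP.down_closed o ho 0 fun i => ⟨le_rfl, (hP.subset_cube ho i).1⟩

/-- The sign of L is not prescribed. If L < 0, the Lipschitz bound collapses P to a point and both
sides vanish. -/
lemma IsSmooth.sq_norm_le_diam {n : ℕ} {L : ℝ} {F : Vec n → ℝ} (hF : IsSmooth L F)
    {P : Set (Vec n)} (hP : IsDownClosedBody P) {x y w : Vec n} (hx : x ∈ P) (hy : y ∈ P)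
    (hw : ‖w‖ ≤ ‖x - y‖) : L * ‖w‖ ^ 2 ≤ L * Metric.diam P ^ 2 := by
  have hd : ∀ a ∈ P, ∀ b ∈ P, ‖a - b‖ ≤ Metric.diam P := fun a ha b hb => by
    rw [← dist_eq_norm]; exact Metric.dist_le_diam_of_mem hP.compact.isBounded ha hb
  rcases le_or_gt 0 L with hL | hL
  · have := hw.trans (hd x hx y hy)
    gcongr
  · have h0 : ∀ a ∈ P, ∀ b ∈ P, dist a b ≤ 0 := by
      intro a ha b hb
      have := (norm_nonneg _).trans (hF.2 a (hP.subset_cube ha) b (hP.subset_cube hb))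
      rw [dist_eq_norm]
      by_contra hne
      nlinarith
    have h1 : Metric.diam P = 0 := le_antisymm (Metric.diam_le_of_forall_dist_le le_rfl h0)
      Metric.diam_nonneg
    have h2 : ‖w‖ = 0 := le_antisymm (hw.trans (by rw [← dist_eq_norm]; exact h0 x hx y hy))
      (norm_nonneg _)
    rw [h1, h2]

lemma IsSmooth.diam_nonneg {n : ℕ} {L : ℝ} {F : Vec n → ℝ} (hF : IsSmooth L F)
    {P : Set (Vec n)} (hP : IsDownClosedBody P) {x : Vec n} (hx : x ∈ P) :
    0 ≤ L * Metric.diam P ^ 2 := by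
  have := hF.sq_norm_le_diam hP (w := 0) hx hx (by simp)
  simpa using this

/-! ### The Frank-Wolfe subroutine -/

lemma IsFrankWolfeOutput.mem {n : ℕ} {F : Vec n → ℝ} {Q : Set (Vec n)} {m : ℕ} {x : Vec n}
    (hQ : Convex ℝ Q) (hm : 0 < m) (h : IsFrankWolfeOutput F Q m x) : x ∈ Q := by
  obtain ⟨u, s, h0, hs, k, hk, -, rfl⟩ := h
  have key : ∀ k, k ≤ m ^ 2 → u k ∈ Q := by
    intro k
    induction k with
    | zero => exact fun _ => h0
    | succ k ih =>
      intro hk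
      obtain ⟨h1, -, h2⟩ := hs k (by omega)
      rw [h2]
      have h3 : 1 / (m : ℝ) ≤ 1 := by
        rw [div_le_one (by exact_mod_cast hm)]
        exact_mod_cast hm
      exact hQ (ih (by omega)) h1 (by linarith) (by positivity) (by ring)
  exact key k hk.le

/-- Let G be the smallest gap. Each of the m² steps of length 1/m raises F by at least G/m -
LD²/(2m²). Starting from a nonnegative value, the last iterate has value at least mG - LD²/2, which
cannot exceed the maximum F(y). -/
lemma IsFrankWolfeOutput.inner_grad_le {n : ℕ} {F : Vec n → ℝ} {L : ℝ} {P Q : Set (Vec n)} {m : ℕ}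
    {x y : Vec n} (hP : IsDownClosedBody P) (hQP : Q ⊆ P) (hQ : Convex ℝ Q) (hm : 0 < m)
    (hF : IsSmooth L F) (hF0 : ∀ x ∈ cube n, 0 ≤ F x) (h : IsFrankWolfeOutput F Q m x)
    (hy : IsMaxOn F Q y) {a : Vec n} (ha : a ∈ Q) :
    inner ℝ (a - x) (grad F x) ≤ 1 / (m : ℝ) * (F y + 1 / 2 * L * Metric.diam P ^ 2) := by
  obtain ⟨u, s, h0, hs, k, hk, hmin, rfl⟩ := h
  have hmR : (0 : ℝ) < m := by exact_mod_cast hm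
  have hh : 1 / (m : ℝ) ≤ 1 := by
    rw [div_le_one hmR]
    exact_mod_cast hm
  set D := Metric.diam P
  set h : ℝ := 1 / (m : ℝ) with hh_def
  have hh0 : 0 < h := by positivity
  set G := inner ℝ (s k - u k) (grad F (u k)) with hG
  have hle : inner ℝ (a - u k) (grad F (u k)) ≤ G := by
    have := (hs k hk).2.1 ha
    simp only [Set.mem_ofPred_eq] at this
    rw [hG, inner_sub_left, inner_sub_left]
    linarith
  refine hle.trans ?_
  have key : ∀ j, j ≤ m ^ 2 → u j ∈ Q ∧
      (j : ℝ) * (h * G - h ^ 2 * (L * D ^ 2) / 2) ≤ F (u j) := by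
    intro j
    induction j with
    | zero => exact fun _ => ⟨h0, by simpa using hF0 _ (hP.subset_cube (hQP h0))⟩
    | succ j ih =>
      intro hj
      obtain ⟨h1, -, h2⟩ := hs j (by omega)
      obtain ⟨i1, i2⟩ := ih (by omega)
      have hmem : u (j + 1) ∈ Q := by
        rw [h2]
        exact hQ i1 h1 (by linarith) (by positivity) (by ring)
      refine ⟨hmem, ?_⟩
      have e : u (j + 1) = u j + h • (s j - u j) := by rw [h2]; module
      have hdesc := hF.descent (hP.subset_cube (hQP i1)) (d := h • (s j - u j))
        (by rw [← e]; exact hP.subset_cube (hQP hmem))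
      rw [← e, real_inner_smul_left, norm_smul, mul_pow, Real.norm_of_nonneg hh0.le] at hdesc
      have hn := hF.sq_norm_le_diam hP (hQP h1) (hQP i1) (w := s j - u j) le_rfl
      have hg := hmin j (by omega)
      have hg' := mul_le_mul_of_nonneg_left hg hh0.le
      have hn' := mul_le_mul_of_nonneg_left hn (sq_nonneg h)
      push_cast
      linarith
  obtain ⟨k1, k2⟩ := key (m ^ 2) le_rfl
  have k3 := k2.trans (hy k1)
  have e1 : ((m ^ 2 : ℕ) : ℝ) * (h * G - h ^ 2 * (L * D ^ 2) / 2) = m * G - L * D ^ 2 / 2 := by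
    rw [hh_def]; push_cast; field_simp
  rw [e1] at k3
  rw [hh_def, one_div, ← div_eq_inv_mul, le_div_iff₀ hmR]
  linarith

lemma exists_isFrankWolfeOutput {n : ℕ} (F : Vec n → ℝ) {Q : Set (Vec n)} {m : ℕ} (hm : 0 < m)
    (hQ : IsCompact Q) (hne : Q.Nonempty) : ∃ x, IsFrankWolfeOutput F Q m x := by
  have hs : ∀ u : Vec n, ∃ s ∈ Q, IsMaxOn (fun v => inner ℝ v (grad F u)) Q s := fun u =>
    hQ.exists_isMaxOn hne (by fun_prop)
  choose S hSQ hSmax using hs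
  obtain ⟨u₀, hu₀⟩ := hne
  let u : ℕ → Vec n := fun k =>
    Nat.rec u₀ (fun _ w => (1 - 1 / (m : ℝ)) • w + (1 / (m : ℝ)) • S w) k
  obtain ⟨k, hk, hmin⟩ := Finset.exists_min_image (Finset.range (m ^ 2))
    (fun l => inner ℝ (S (u l) - u l) (grad F (u l))) ⟨0, Finset.mem_range.2 (by positivity)⟩
  exact ⟨u k, u, fun k => S (u k), hu₀, fun k _ => ⟨hSQ _, hSmax _, rfl⟩, k,
    Finset.mem_range.1 hk, fun l hl => hmin l (Finset.mem_range.2 hl), rfl⟩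

/-- An approximate first-order stationary point is comparable to joins and meets. -/
lemma IsWeaklyDR.le_of_inner_grad_le {n : ℕ} {γ : ℝ} {F : Vec n → ℝ} (hF : IsWeaklyDR γ F)
    (hd : DifferentiableOn ℝ F (cube n)) (hγ : 0 < γ) {x o : Vec n} (hx : x ∈ cube n)
    (ho : o ∈ cube n) {η : ℝ} (hη : inner ℝ (o - x) (grad F x) ≤ η) :
    (γ ^ 2 * F (vjoin x o) + F (vmeet x o)) / (1 + γ ^ 2) - γ / (1 + γ ^ 2) * η ≤ F x := by
  have e1 : x + (vjoin x o - x) = vjoin x o := by abel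
  have e2 : x - (x - vmeet x o) = vmeet x o := by abel
  have hj : vjoin x o ∈ cube n := fun i => by
    have := hx i; have := ho i; simp only [vjoin_apply]
    exact ⟨le_max_of_le_left (hx i).1, max_le (hx i).2 (ho i).2⟩
  have hm : vmeet x o ∈ cube n := fun i => by
    simp only [vmeet_apply]
    exact ⟨le_min (hx i).1 (ho i).1, min_le_of_left_le (hx i).2⟩
  have h1 := hF.le_inner_grad hd hx (d := vjoin x o - x) (by rwa [e1]) (fun j => by simp)
  have h2 := hF.inner_grad_le hd hx (d := x - vmeet x o) (by rwa [e2]) (fun j => by simp)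
  rw [e1] at h1
  rw [e2] at h2
  -- Since max + min is the sum, o - x is a nonnegative move up to the join minus a nonnegative move
  -- down to the meet; each gradient bound handles one of them.
  have e3 : o - x = (vjoin x o - x) - (x - vmeet x o) := by
    ext j
    simp only [PiLp.sub_apply, vjoin_apply, vmeet_apply]
    linarith [max_add_min (x j) (o j)]
  rw [e3, inner_sub_left] at hη
  rw [div_mul_eq_mul_div, ← sub_div, div_le_iff₀ (by positivity)]
  nlinarith

/-! ### Function values at probabilistic sums -/

section Values

variable {n : ℕ} {γ : ℝ} {F : Vec n → ℝ} {P : Set (Vec n)}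

/-- The point z⊕o may lie outside P, so optimality of o does not apply to it directly. But z⊕o = o +
z⊙(1-o), and z⊙(1-o) ∈ P by down-closedness, so comparison with the increment from 0 applies.
Because F(z⊕o) is controlled only up to 1/γ, later errors multiplying it must carry a factor γ. -/
lemma IsWeaklyDR.mul_psum_le (hF : IsWeaklyDR γ F) (hγ : γ ≤ 1)
    (hF0 : ∀ x ∈ cube n, 0 ≤ F x) (hP : IsDownClosedBody P) {z o : Vec n} (hz : z ∈ P) (ho : o ∈ P)
    (hmax : IsMaxOn F P o) : γ * F (psum z o) ≤ 2 * F o := by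
  have hzc := hP.subset_cube hz
  have hoc := hP.subset_cube ho
  have e : o + had z (ones n - o) = psum z o := by ext j; simp; ring
  have h := hF.increment_le (x := 0) (y := o) (d := had z (ones n - o)) (zero_mem_cube n)
    (fun j => (hoc j).1) (fun j => mul_nonneg (hzc j).1 (sub_nonneg.2 (hoc j).2))
    (by rw [e]; exact psum_mem_cube hzc hoc)
  rw [e, zero_add] at h
  have h1 : F (had z (ones n - o)) ≤ F o := hmax (hP.down_closed z hz _ fun j => by
    have h1 := hzc j
    have h2 := hoc j
    simp only [had_apply, PiLp.sub_apply, ones_apply]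
    constructor <;> nlinarith)
  have h2 := hF0 0 (zero_mem_cube n)
  have h3 := hF0 o hoc
  nlinarith

/-- The two arguments differ by exactly z⊙o, and the increment along z⊙o is at most 1/γ times the
one from 0. -/
lemma IsWeaklyDR.psum_sub_le (hF : IsWeaklyDR γ F) (hγ : 0 < γ)
    (hF0 : ∀ x ∈ cube n, 0 ≤ F x) {y z o : Vec n} (hy : y ∈ cube n) (hz : z ∈ cube n)
    (ho : o ∈ cube n) (hyz : ∀ j, y j + z j ≤ 1) :
    F (psum y o) - F (had z o) / γ ≤ F (y + had (ones n - y - z) o) := by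
  have e : y + had (ones n - y - z) o + had z o = psum y o := by ext j; simp; ring
  have h := hF.increment_le (x := 0) (y := y + had (ones n - y - z) o) (d := had z o)
    (zero_mem_cube n)
    (fun j => by
      have := mul_nonneg (sub_nonneg.2 (hyz j)) (ho j).1
      have := (hy j).1
      simp only [PiLp.add_apply, had_apply, PiLp.sub_apply, ones_apply, PiLp.zero_apply]
      linarith)
    (fun j => mul_nonneg (hz j).1 (ho j).1) (by rw [e]; exact psum_mem_cube hy ho)
  rw [e, zero_add] at h
  have h2 := hF0 0 (zero_mem_cube n)
  have : F (psum y o) - F (y + had (ones n - y - z) o) ≤ F (had z o) / γ := by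
    rw [le_div_iff₀ hγ]; linarith
  linarith

/-- For γ = 1, put c = 1 - b^i. Then y/c is in the cube and y⊕w lies at fraction c of the segment
from w to (y/c)⊕w; interpolate and drop the nonnegative far value. For γ < 1, monotonicity and b^i ≤
1 suffice. -/
lemma IsWeaklyDR.pow_mul_le_psum (hF : IsWeaklyDR γ F) (hd : DifferentiableOn ℝ F (cube n))
    (hγ1 : γ ≤ 1) (hF0 : ∀ x ∈ cube n, 0 ≤ F x) {b : ℝ} (hb0 : 0 < b)
    (hb1 : b < 1) {h : ℝ} (hbh : γ = 1 → b = 1 - h) {i : ℕ} {y w : Vec n} (hy : y ∈ cube n)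
    (hw : w ∈ cube n) (hyi : ∀ j, (1 - h) ^ i ≤ 1 - y j) : b ^ i * F w ≤ F (psum y w) := by
  have hpc := psum_mem_cube hy hw
  have hbi : b ^ i ≤ 1 := pow_le_one₀ hb0.le hb1.le
  rcases hF.monotone_or hγ1 with h1 | hmono
  · rw [← hbh h1] at hyi
    -- When b^i = 1 the fraction c is 0 and cannot be divided by, but then y = 0.
    rcases hbi.eq_or_lt with hi | hi
    · have : y = 0 := by
        ext j
        have := hyi j
        rw [hi] at this
        exact le_antisymm (by simpa using this) (hy j).1
      have e : psum y w = w := by ext j; simp [this]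
      rw [e, hi, one_mul]
    · set c := 1 - b ^ i with hc
      have hc0 : 0 < c := by linarith
      have hc1 : c ≤ 1 := by have := pow_pos hb0 i; linarith
      have e : w + c • had (c⁻¹ • y) (ones n - w) = psum y w := by
        ext j; simp; field_simp; ring
      have hq : ∀ j, 0 ≤ c⁻¹ * y j ∧ c⁻¹ * y j ≤ 1 := fun j =>
        ⟨mul_nonneg (by positivity) (hy j).1, by
          rw [inv_mul_le_iff₀ hc0]; have := hyi j; linarith⟩
      have e2 : w + had (c⁻¹ • y) (ones n - w) = psum (c⁻¹ • y) w := by ext j; simp; ring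
      have hqc : psum (c⁻¹ • y) w ∈ cube n := psum_mem_cube (fun j => hq j) hw
      have := hF.interpolate hd (by linarith) hw (d := had (c⁻¹ • y) (ones n - w))
        (by rwa [e2]) (fun j => mul_nonneg (hq j).1 (sub_nonneg.2 (hw j).2)) hc0.le hc1
      rw [e, e2, h1] at this
      have h3 := mul_nonneg hc0.le (hF0 _ hqc)
      have h4 : b ^ i = 1 - c := by rw [hc]; ring
      rw [h4]
      nlinarith
  · have h1 : F w ≤ F (psum y w) := hmono w hw _ hpc fun j => by
      have := mul_nonneg (hy j).1 (sub_nonneg.2 (hw j).2)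
      simp only [psum_apply]; linarith
    have h2 := hF0 w hw
    nlinarith

/-- For γ = 1, interpolate from o to (y/c)⊕o = o + d with c = 1 - b^i. Now y/c ≤ 1 - z, so d can
also be added to z⊕o inside the cube, and comparing increments gives F(o+d) ≥ F(o) - F(z⊕o). For γ <
1, monotonicity makes the term F(o) - F(z⊕o) nonpositive and gives F(o) ≤ F(y⊕o). -/
lemma IsWeaklyDR.psum_lower_of_disjoint (hF : IsWeaklyDR γ F) (hd : DifferentiableOn ℝ F (cube n))
    (hγ0 : 0 < γ) (hγ1 : γ ≤ 1) (hF0 : ∀ x ∈ cube n, 0 ≤ F x) {b : ℝ} (hb0 : 0 < b)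
    (hb1 : b < 1) {h : ℝ} (hbh : γ = 1 → b = 1 - h) {i : ℕ} {y z o : Vec n} (hy : y ∈ cube n)
    (hz : z ∈ cube n) (ho : o ∈ cube n) (hyi : ∀ j, (1 - h) ^ i * (1 - z j) ≤ 1 - z j - y j) :
    b ^ i * F o + (1 - b ^ i) / γ * (F o - F (psum z o)) ≤ F (psum y o) := by
  have hpc := psum_mem_cube hy ho
  have hzc := psum_mem_cube hz ho
  have hbi : b ^ i ≤ 1 := pow_le_one₀ hb0.le hb1.le
  rcases hF.monotone_or hγ1 with h1 | hmono
  · rw [← hbh h1] at hyi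
    rcases hbi.eq_or_lt with hi | hi
    · have : y = 0 := by
        ext j
        have := hyi j
        rw [hi] at this
        exact le_antisymm (by rw [PiLp.zero_apply]; linarith) (hy j).1
      have e : psum y o = o := by ext j; simp [this]
      rw [e, hi]
      simp
    · set c := 1 - b ^ i with hc
      have hc0 : 0 < c := by linarith
      have hc1 : c ≤ 1 := by have := pow_pos hb0 i; linarith
      have e : o + c • had (c⁻¹ • y) (ones n - o) = psum y o := by
        ext j; simp; field_simp; ring
      have hq : ∀ j, 0 ≤ c⁻¹ * y j ∧ c⁻¹ * y j ≤ 1 - z j := fun j =>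
        ⟨mul_nonneg (by positivity) (hy j).1, by
          rw [inv_mul_le_iff₀ hc0]; have := hyi j; rw [hc]; linarith⟩
      have e2 : o + had (c⁻¹ • y) (ones n - o) = psum (c⁻¹ • y) o := by ext j; simp; ring
      have hqc : psum (c⁻¹ • y) o ∈ cube n :=
        psum_mem_cube (fun j => ⟨(hq j).1, (hq j).2.trans (by linarith [(hz j).1])⟩) ho
      have hq0 : ∀ j, 0 ≤ had (c⁻¹ • y) (ones n - o) j :=
        fun j => mul_nonneg (hq j).1 (sub_nonneg.2 (ho j).2)
      have h2 := hF.interpolate hd (by linarith) ho (d := had (c⁻¹ • y) (ones n - o))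
        (by rwa [e2]) hq0 hc0.le hc1
      rw [e, e2, h1] at h2
      have hsum : psum z o + had (c⁻¹ • y) (ones n - o) ∈ cube n := fun j => by
        have a1 := mul_nonneg (sub_nonneg.2 (hq j).2) (sub_nonneg.2 (ho j).2)
        have a2 := mul_nonneg (hq j).1 (sub_nonneg.2 (ho j).2)
        have a3 := (hzc j).1
        simp only [PiLp.add_apply, psum_apply, had_apply, PiLp.smul_apply, smul_eq_mul,
          PiLp.sub_apply, ones_apply] at a3 ⊢
        constructor <;> nlinarith
      have h3 := hF.increment_le (x := o) (y := psum z o) (d := had (c⁻¹ • y) (ones n - o)) ho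
        (fun j => by
          have := mul_nonneg (hz j).1 (sub_nonneg.2 (ho j).2)
          simp only [psum_apply]; linarith) hq0 hsum
      rw [e2, h1] at h3
      have h4 := hF0 _ hsum
      have h5 := mul_le_mul_of_nonneg_left h3 hc0.le
      have h6 := mul_nonneg hc0.le h4
      have h7 : b ^ i = 1 - c := by rw [hc]; ring
      rw [h7, h1, div_one]
      nlinarith
  · have h1 : F o ≤ F (psum y o) := hmono o ho _ hpc fun j => by
      have := mul_nonneg (hy j).1 (sub_nonneg.2 (ho j).2)
      simp only [psum_apply]; linarith
    have h1' : F o ≤ F (psum z o) := hmono o ho _ hzc fun j => by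
      have := mul_nonneg (hz j).1 (sub_nonneg.2 (ho j).2)
      simp only [psum_apply]; linarith
    have h2 := hF0 o ho
    have h3 : 0 ≤ (1 - b ^ i) / γ := div_nonneg (by linarith) hγ0.le
    nlinarith

/-- The update moves y⊕o the fraction h of the way to y⊕(x⊕o). For h equal to the step size,
dividing by the right-hand coefficient gives the weights 1 - β and β; this is the origin of β. -/
lemma IsWeaklyDR.psum_step (hF : IsWeaklyDR γ F) (hd : DifferentiableOn ℝ F (cube n))
    (hγ0 : 0 < γ) {h : ℝ} (hh0 : 0 ≤ h) (hh1 : h ≤ 1) {y x o : Vec n} (hy : y ∈ cube n)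
    (hx : x ∈ cube n) (ho : o ∈ cube n) :
    (1 - h) * F (psum y o) + γ ^ 2 * h * F (psum y (psum x o))
      ≤ (1 - h + γ ^ 2 * h) * F (psum (y + h • had (ones n - y) x) o) := by
  have e1 : psum y o + h • (psum y (psum x o) - psum y o)
      = psum (y + h • had (ones n - y) x) o := by ext j; simp; ring
  have e2 : psum y o + (psum y (psum x o) - psum y o) = psum y (psum x o) := by abel
  have := hF.interpolate hd hγ0 (psum_mem_cube hy ho) (d := psum y (psum x o) - psum y o)
    (by rw [e2]; exact psum_mem_cube hy (psum_mem_cube hx ho))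
    (fun j => by
      have := mul_nonneg (mul_nonneg (sub_nonneg.2 (hy j).2) (hx j).1) (sub_nonneg.2 (ho j).2)
      simp only [PiLp.sub_apply, psum_apply]; linarith) hh0 hh1
  rwa [e1, e2] at this

end Values

/-! ### Numerical parameters -/

namespace Params

/-- The ranges of the numerical parameters. -/
structure Admissible (p : Params) : Prop where
  γ_pos : 0 < p.γ
  γ_le : p.γ ≤ 1
  tS_pos : 0 < p.tS
  tS_lt : p.tS < 1
  ε_pos : 0 < p.ε
  ε_lt : p.ε < 1 / 2
  δ_pos : 0 < p.δ
  δ_lt : p.δ < 1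

variable {p : Params} (hp : p.Admissible)

namespace Admissible

include hp

lemma min_pos : 0 < min p.δ p.ε := lt_min hp.δ_pos hp.ε_pos

lemma three_le_m : 3 ≤ p.m := by
  have h1 : (2 : ℝ) < 1 / min p.δ p.ε := by
    rw [lt_div_iff₀ hp.min_pos]
    linarith [min_le_right p.δ p.ε, hp.ε_lt]
  have h2 : (2 : ℝ) < p.m := h1.trans_le (Nat.le_ceil _ : 1 / min p.δ p.ε ≤ p.m)
  exact_mod_cast h2

lemma m_pos : (0 : ℝ) < p.m := by
  have := hp.three_le_m
  have : (3 : ℝ) ≤ p.m := by exact_mod_cast this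
  linarith

lemma step_pos : 0 < p.step := one_div_pos.2 hp.m_pos

lemma m_mul_step : (p.m : ℝ) * p.step = 1 := by
  rw [step, mul_one_div_cancel hp.m_pos.ne']

lemma step_le_third : p.step ≤ 1 / 3 := by
  have : (3 : ℝ) ≤ p.m := by exact_mod_cast hp.three_le_m
  exact one_div_le_one_div_of_le (by norm_num) this

lemma step_le_min : p.step ≤ min p.δ p.ε := by
  rw [step, one_div_le hp.m_pos hp.min_pos]
  exact (Nat.le_ceil _ : 1 / min p.δ p.ε ≤ p.m)

lemma m_le : (p.m : ℝ) ≤ 2 * (p.δ⁻¹ + p.ε⁻¹) := by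
  have h1 : (p.m : ℝ) < 1 / min p.δ p.ε + 1 := Nat.ceil_lt_add_one (one_div_pos.2 hp.min_pos).le
  have h2 : 1 ≤ p.δ⁻¹ := (one_le_inv₀ hp.δ_pos).2 hp.δ_lt.le
  have h3 : 0 < p.ε⁻¹ := inv_pos.2 hp.ε_pos
  have h4 : 1 / min p.δ p.ε ≤ p.δ⁻¹ + p.ε⁻¹ := by
    rcases min_choice p.δ p.ε with h | h <;> rw [h, one_div] <;> linarith
  linarith

lemma tS_le_iS : p.tS ≤ p.iS * p.step := by
  rw [← div_le_iff₀ hp.step_pos]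
  exact Nat.le_ceil _

lemma iS_lt : p.iS * p.step < p.tS + p.step := by
  have h1 : (p.iS : ℝ) < p.tS / p.step + 1 :=
    Nat.ceil_lt_add_one (div_pos hp.tS_pos hp.step_pos).le
  have h2 := mul_lt_mul_of_pos_right h1 hp.step_pos
  rwa [add_mul, div_mul_cancel₀ _ hp.step_pos.ne', one_mul] at h2

lemma iS_le : p.iS ≤ p.m := by
  refine Nat.ceil_le.2 ?_
  rw [div_le_iff₀ hp.step_pos, hp.m_mul_step]
  exact hp.tS_lt.le

lemma denom_pos : 0 < 1 - p.step + p.γ ^ 2 * p.step := by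
  have := hp.step_le_third
  have := mul_pos (pow_pos hp.γ_pos 2) hp.step_pos
  linarith

lemma one_sub_β : 1 - p.β = (1 - p.step) / (1 - p.step + p.γ ^ 2 * p.step) := by
  have := hp.denom_pos
  rw [β]; field_simp; ring

lemma β_pos : 0 < p.β :=
  div_pos (mul_pos (pow_pos hp.γ_pos 2) hp.step_pos) hp.denom_pos

lemma one_sub_β_pos : 0 < 1 - p.β := by
  rw [hp.one_sub_β]
  exact div_pos (by linarith [hp.step_le_third]) hp.denom_pos

lemma γ_sq_le : p.γ ^ 2 ≤ 1 := pow_le_one₀ hp.γ_pos.le hp.γ_le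

lemma one_sub_step_le : 1 - p.step ≤ 1 - p.β := by
  rw [hp.one_sub_β, le_div_iff₀ hp.denom_pos]
  have h1 := hp.step_le_third
  have h2 := hp.step_pos
  have h3 := hp.γ_sq_le
  nlinarith [mul_nonneg (mul_nonneg (by linarith : 0 ≤ 1 - p.step) h2.le) (sub_nonneg.2 h3)]

lemma β_div : p.β / (1 - p.β) = p.γ ^ 2 * p.step / (1 - p.step) := by
  have h1 : 0 < 1 - p.step := by linarith [hp.step_le_third]
  rw [hp.one_sub_β, β, div_div_div_cancel_right₀ hp.denom_pos.ne']

/-- Since β is at most the step, 1/(1-β) ≤ 1 + 1/(m-1) ≤ exp(1/(m-1)); at most m - 1 such factors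
give at most e < 3. -/
lemma inv_pow_le {i : ℕ} (hi : i < p.m) : ((1 - p.β) ^ i)⁻¹ ≤ 3 := by
  have hm := hp.three_le_m
  have h1 : 0 < 1 - p.step := by linarith [hp.step_le_third]
  have h2 : (1 - p.step)⁻¹ ^ i ≤ 3 := by
    have hm1 : (0 : ℝ) < (p.m : ℝ) - 1 := by
      have : (3 : ℝ) ≤ p.m := by exact_mod_cast hm
      linarith
    have e : (1 - p.step)⁻¹ = 1 / ((p.m : ℝ) - 1) + 1 := by
      rw [step]
      have := hp.m_pos
      field_simp
      ring
    have h3 : (1 - p.step)⁻¹ ≤ Real.exp (1 / ((p.m : ℝ) - 1)) := by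
      rw [e]; exact Real.add_one_le_exp _
    have h4 : (i : ℝ) ≤ (p.m : ℝ) - 1 := by
      have : (i : ℝ) + 1 ≤ p.m := by exact_mod_cast hi
      linarith
    calc (1 - p.step)⁻¹ ^ i ≤ Real.exp (1 / ((p.m : ℝ) - 1)) ^ i :=
          pow_le_pow_left₀ (by positivity) h3 i
      _ = Real.exp (i * (1 / ((p.m : ℝ) - 1))) := by rw [Real.exp_nat_mul]
      _ ≤ Real.exp 1 := by
          rw [Real.exp_le_exp, mul_one_div, div_le_one hm1]; exact h4
      _ ≤ 3 := Real.exp_one_lt_three.le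
  rw [← inv_pow]
  exact (pow_le_pow_left₀ (inv_nonneg.2 hp.one_sub_β_pos.le)
    (inv_anti₀ h1 hp.one_sub_step_le) i).trans h2

lemma mul_β_div_le {k : ℕ} (hk : k + 1 ≤ p.m) : (k : ℝ) * (p.β / (1 - p.β)) ≤ 1 := by
  have h1 : 0 < 1 - p.step := by linarith [hp.step_le_third]
  have h2 : (k : ℝ) + 1 ≤ p.m := by exact_mod_cast hk
  have h3 := mul_le_mul_of_nonneg_right h2 hp.step_pos.le
  rw [hp.m_mul_step] at h3
  rw [hp.β_div, ← mul_div_assoc, div_le_one h1]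
  have h4 : 0 ≤ (k : ℝ) * p.step := mul_nonneg (Nat.cast_nonneg _) hp.step_pos.le
  nlinarith [hp.γ_sq_le]

end Admissible

end Params

namespace Params

variable {n : ℕ} {p : Params} {F : Vec n → ℝ} {P : Set (Vec n)} {z o : Vec n}

/-! ### The thresholds -/

/-- The term -2εg in the threshold pays for the errors of g_⊙ and g_⊕, each at most εg. -/
lemma Admissible.v₁_le (hp : p.Admissible) (hv : p.ValidSurrogates F z o) (i : ℕ) :
    p.v₁ i ≤ (1 - p.β) ^ i * F o + (1 - (1 - p.β) ^ i) / p.γ * (F o - F (psum z o))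
      - F (had z o) / p.γ := by
  have hb0 := hp.one_sub_β_pos
  have hbi : (1 - p.β) ^ i ≤ 1 := pow_le_one₀ hb0.le (by linarith [hp.β_pos])
  have hbi0 : 0 < (1 - p.β) ^ i := pow_pos hb0 i
  obtain ⟨h1, h2, h3, h4, h5, h6⟩ := hv
  rw [v₁]
  set c := (1 - p.β) ^ i
  have hγ := hp.γ_pos
  have hFo : 0 ≤ p.ε * F o := by linarith
  have hg : 0 ≤ p.ε * p.g := by
    have : 0 ≤ F o := nonneg_of_mul_nonneg_right hFo hp.ε_pos
    have := hp.ε_lt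
    have := hp.ε_pos
    exact mul_nonneg hp.ε_pos.le (by nlinarith)
  have key : p.γ * ((c + (1 - c - 2 * p.ε) / p.γ) * p.g - 1 / p.γ * p.gOdot
        - (1 - c) / p.γ * p.gOplus)
      ≤ p.γ * (c * F o + (1 - c) / p.γ * (F o - F (psum z o)) - F (had z o) / p.γ) := by
    have e1 : p.γ * ((c + (1 - c - 2 * p.ε) / p.γ) * p.g - 1 / p.γ * p.gOdot
        - (1 - c) / p.γ * p.gOplus)
        = (p.γ * c + (1 - c)) * p.g - 2 * (p.ε * p.g) - p.gOdot - (1 - c) * p.gOplus := by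
      field_simp; ring
    have e2 : p.γ * (c * F o + (1 - c) / p.γ * (F o - F (psum z o)) - F (had z o) / p.γ)
        = (p.γ * c + (1 - c)) * F o - (1 - c) * F (psum z o) - F (had z o) := by
      field_simp; ring
    rw [e1, e2]
    have a1 : 0 ≤ p.γ * c + (1 - c) := by
      have := mul_pos hγ hbi0
      linarith
    have a2 := mul_le_mul_of_nonneg_left h2 a1
    have a3 := mul_le_mul_of_nonneg_left h5 (sub_nonneg.2 hbi)
    have a4 := mul_nonneg hbi0.le hg
    linarith
  exact le_of_mul_le_mul_left key hγ

/-- The threshold uses slope β per step, while the value guaranteed for o grows with slope β/(1-β);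
the excess is harmless because F(z⊕o) ≥ 0. The reserve (1 + 3/γ)εg covers the drift loss, at most
2εg, and the error of g_⊕, at most (2/γ)εg. -/
lemma Admissible.v₂_le (hp : p.Admissible) (hv : p.ValidSurrogates F z o)
    (hG : 0 ≤ F (psum z o)) {k : ℕ} (hi : p.iS + k < p.m) :
    p.v₂ (p.iS + k) ≤ (1 - p.β) ^ (p.iS + k) * (F o + (((1 - p.β) ^ p.iS)⁻¹ - 1) / p.γ
      * (F o - F (psum z o)) + k * (p.β / (1 - p.β)) * (F (psum z o) - p.ε * F o)) := by
  have hb0 := hp.one_sub_β_pos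
  have hb1 : 1 - p.β ≤ 1 := by linarith [hp.β_pos]
  have hB3 := hp.inv_pow_le (i := p.iS) (by omega)
  have hB1 : 1 ≤ ((1 - p.β) ^ p.iS)⁻¹ := (one_le_inv₀ (pow_pos hb0 _)).2 (pow_le_one₀ hb0.le hb1)
  have hk1 := hp.mul_β_div_le (k := k) (by omega)
  have hκ : k * p.β ≤ k * (p.β / (1 - p.β)) := by
    refine mul_le_mul_of_nonneg_left ?_ (Nat.cast_nonneg _)
    rw [le_div_iff₀ hb0]
    nlinarith [hp.β_pos]
  have hk0 : 0 ≤ (k : ℝ) * p.β := mul_nonneg (Nat.cast_nonneg _) hp.β_pos.le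
  obtain ⟨h1, h2, -, -, h5, h6⟩ := hv
  rw [v₂]
  refine mul_le_mul_of_nonneg_left ?_ (pow_pos hb0 _).le
  have e : ((p.iS + k : ℕ) : ℝ) - p.iS = k := by push_cast; ring
  rw [e]
  set B := ((1 - p.β) ^ p.iS)⁻¹
  set κ := (k : ℝ) * (p.β / (1 - p.β))
  rw [mul_comm (k : ℝ)] at hκ hk0
  set κ₀ := p.β * (k : ℝ)
  have hγ := hp.γ_pos
  have hε := hp.ε_pos
  have hFo : 0 ≤ F o := nonneg_of_mul_nonneg_right (a := p.ε) (by linarith) hε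
  have hg2 : F o ≤ 2 * p.g := by nlinarith [hp.ε_lt]
  have hg0 : 0 ≤ p.ε * p.g := mul_nonneg hε.le (by linarith)
  set r := 1 / p.γ with hr
  have hr1 : 1 ≤ r := by rw [hr, one_le_div hγ]; exact hp.γ_le
  have e1 : B / p.γ = B * r := by rw [hr]; ring
  have e2 : (B - 1) / p.γ = B * r - r := by rw [hr]; ring
  have e3 : 3 / p.γ = 3 * r := by rw [hr]; ring
  rw [e1, e2, e3]
  have hBr : r ≤ B * r := by nlinarith
  have a1 : (B * r + 1 - r) * p.g ≤ (B * r + 1 - r) * F o :=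
    mul_le_mul_of_nonneg_left h2 (by linarith)
  have a2 : κ * (p.ε * F o) ≤ 2 * (p.ε * p.g) := by
    have : p.ε * F o ≤ 2 * (p.ε * p.g) := by nlinarith
    have h0 : 0 ≤ p.ε * F o := by positivity
    nlinarith
  have a3 : (κ₀ - κ) * F (psum z o) ≤ 0 := mul_nonpos_of_nonpos_of_nonneg (by linarith) hG
  have a4 : (B * r - r - κ₀) * (F (psum z o) - p.gOplus) ≤ 2 * r * (p.ε * p.g) := by
    -- The coefficient of g_⊕ can have either sign: the lower surrogate bound serves one case, the
    -- upper bound the other.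
    rcases le_total 0 (B * r - r - κ₀) with hK | hK
    · refine (mul_le_mul_of_nonneg_left (by linarith : _ ≤ p.ε * p.g) hK).trans ?_
      refine mul_le_mul_of_nonneg_right ?_ hg0
      nlinarith
    · have : 0 ≤ 2 * r * (p.ε * p.g) := by positivity
      have := mul_nonpos_of_nonpos_of_nonneg hK (sub_nonneg.2 h6)
      linarith
  have a5 : p.ε * p.g ≤ r * (p.ε * p.g) := by nlinarith
  linarith

/-! ### Membership of the comparator in the feasible sets -/

lemma convex_Q (hP : Convex ℝ P) (i : ℕ) (y : Vec n) : Convex ℝ (p.Q F P z i y) :=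
  hP.inter (convex_halfSpace_ge (innerₛₗ ℝ (p.weight F z i y)).isLinear _)

lemma isCompact_Q (hP : IsCompact P) (i : ℕ) (y : Vec n) : IsCompact (p.Q F P z i y) :=
  have h : IsClosed {x : Vec n | p.γ * (p.v i - F y) ≤ inner ℝ (p.weight F z i y) x} :=
    isClosed_le continuous_const (continuous_const.inner continuous_id)
  hP.inter_right h

lemma Q_subset (i : ℕ) (y : Vec n) : p.Q F P z i y ⊆ P := fun _ h => h.1

/-- The product ⟨w, o⟩ is the derivative of F at y along (1-y-z)⊙o, a nonnegative direction staying
in the cube. -/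
lemma mem_Q_of_v_le (hF : IsWeaklyDR p.γ F) (hd : DifferentiableOn ℝ F (cube n))
    (hγ : 0 < p.γ) (ho : o ∈ P) (hoc : o ∈ cube n) {i : ℕ} {y : Vec n} (hy : y ∈ cube n)
    (hs : ∀ j, 0 ≤ p.seed z i j) (hys : ∀ j, y j + p.seed z i j ≤ 1)
    (hv : p.v i ≤ F (y + had (ones n - y - p.seed z i) o)) : o ∈ p.Q F P z i y := by
  refine ⟨ho, ?_⟩
  rw [weight, inner_had_left]
  refine le_trans ?_ (hF.le_inner_grad hd hy (d := had (ones n - y - p.seed z i) o) ?_ ?_)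
  · exact mul_le_mul_of_nonneg_left (by linarith) hγ.le
  · intro j
    have a1 := hoc j
    have a2 := hy j
    have a3 := hys j
    have a4 := hs j
    simp only [PiLp.add_apply, had_apply, PiLp.sub_apply, ones_apply]
    constructor <;> nlinarith [mul_nonneg (sub_nonneg.2 a3) a1.1,
      mul_nonneg (sub_nonneg.2 a3) (sub_nonneg.2 a1.2)]
  · exact fun j => mul_nonneg (by have := hys j; simp; linarith) (hoc j).1

/-! ### Invariants of a run -/

lemma IsRun.x_mem {x y : ℕ → Vec n} (hr : p.IsRun F P z x y) (hP : IsDownClosedBody P)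
    {i : ℕ} (hi : i < p.m) : x (i + 1) ∈ P := by
  by_cases h : (p.Q F P z i (y i)).Nonempty
  · exact Q_subset _ _ ((hr.choose_x i hi h).mem (convex_Q hP.convex _ _) (by omega))
  · exact hr.arbitrary_x i hi h

/-- The coordinatewise bounds satisfied by the iterate `y i` of a run. -/
structure IterateBounds (p : Params) (z : Vec n) (x y : ℕ → Vec n) (i : ℕ) : Prop where
  mem_cube : y i ∈ cube n
  pow_le : ∀ j, (1 - p.step) ^ i ≤ 1 - y i j
  pow_mul_le : i ≤ p.iS → ∀ j, (1 - p.step) ^ i * (1 - z j) ≤ 1 - z j - y i j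
  le_sum : ∀ j, y i j ≤ (∑ k ∈ Finset.range i, p.step • x (k + 1)) j

/-- As 0 ≤ x ≤ 1, one step shrinks 1 - y, and before the switch also 1 - z - y, by a factor no
smaller than 1 - h. -/
lemma IsRun.iterateBounds {x y : ℕ → Vec n} (hr : p.IsRun F P z x y) (hp : p.Admissible)
    (hP : IsDownClosedBody P) (hz : z ∈ P) {i : ℕ} (hi : i ≤ p.m) : IterateBounds p z x y i := by
  have hh0 := hp.step_pos
  have hh1 := hp.step_le_third
  have hzc := hP.subset_cube hz
  induction i with
  | zero =>
    constructor <;> simp [hr.init, zero_mem_cube]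
  | succ i ih =>
    obtain ⟨h1, h2, h3, h4⟩ := ih (by omega)
    have hx := hP.subset_cube (hr.x_mem hP (i := i) (by omega))
    have hs : ∀ j, 0 ≤ p.seed z i j := fun j => by
      unfold seed
      split_ifs
      · exact (hzc j).1
      · simp
    have hys : ∀ j, 0 ≤ 1 - y i j - p.seed z i j := fun j => by
      unfold seed
      split_ifs with hlt
      · have := h3 hlt.le j
        have : 0 ≤ (1 - p.step) ^ i * (1 - z j) :=
          mul_nonneg (pow_nonneg (by linarith) _) (sub_nonneg.2 (hzc j).2)
        linarith
      · have := (h1 j).2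
        simp
        linarith
    have hy : ∀ j, y (i + 1) j
        = y i j + p.step * ((1 - y i j - p.seed z i j) * x (i + 1) j) := fun j => by
      rw [hr.update_y i (by omega)]; simp
    have hinc0 : ∀ j, 0 ≤ p.step * ((1 - y i j - p.seed z i j) * x (i + 1) j) := fun j =>
      mul_nonneg hh0.le (mul_nonneg (hys j) (hx j).1)
    have hinc1 : ∀ j, p.step * ((1 - y i j - p.seed z i j) * x (i + 1) j)
        ≤ p.step * (1 - y i j - p.seed z i j) := fun j =>
      mul_le_mul_of_nonneg_left (mul_le_of_le_one_right (hys j) (hx j).2) hh0.le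
    have hinc2 : ∀ j, p.step * ((1 - y i j - p.seed z i j) * x (i + 1) j)
        ≤ p.step * x (i + 1) j := fun j =>
      mul_le_mul_of_nonneg_left (mul_le_of_le_one_left (hx j).1
        (by linarith [hs j, (h1 j).1])) hh0.le
    have hpow : ∀ j, (1 - p.step) ^ (i + 1) ≤ 1 - y (i + 1) j := fun j => by
      rw [hy, pow_succ]
      have := mul_le_mul_of_nonneg_right (h2 j) (by linarith : 0 ≤ 1 - p.step)
      have := hinc1 j
      have := mul_nonneg hh0.le (hs j)
      nlinarith
    refine ⟨fun j => ⟨?_, ?_⟩, hpow, fun hle j => ?_, fun j => ?_⟩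
    · rw [hy]; linarith [hinc0 j, (h1 j).1]
    · have := hpow j
      have : 0 ≤ (1 - p.step) ^ (i + 1) := pow_nonneg (by linarith) _
      linarith
    · have a1 := mul_le_mul_of_nonneg_right (h3 (by omega) j) (by linarith : 0 ≤ 1 - p.step)
      have a2 := hinc1 j
      have a3 : p.seed z i j = z j := by rw [seed, if_pos (by omega)]
      rw [hy, pow_succ]
      rw [a3] at a2 ⊢
      nlinarith
    · rw [hy, Finset.sum_range_succ, PiLp.add_apply]
      have := hinc2 j
      simp only [PiLp.smul_apply, smul_eq_mul]
      linarith [h4 j]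

lemma IterateBounds.add_seed_le {x y : ℕ → Vec n} {i : ℕ} (h : IterateBounds p z x y i)
    (hp : p.Admissible) (hz : z ∈ cube n) (j : Fin n) : y i j + p.seed z i j ≤ 1 := by
  unfold seed
  split_ifs with hlt
  · have := h.pow_mul_le hlt.le j
    have : 0 ≤ (1 - p.step) ^ i * (1 - z j) :=
      mul_nonneg (pow_nonneg (by linarith [hp.step_le_third]) _) (sub_nonneg.2 (hz j).2)
    linarith
  · simpa using (h.mem_cube j).2

lemma seed_nonneg (hz : z ∈ cube n) (i : ℕ) (j : Fin n) : 0 ≤ p.seed z i j := by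
  unfold seed
  split_ifs
  · exact (hz j).1
  · simp

/-- The output lies below the average of x(1), …, x(m), which is in P by convexity. -/
lemma IsRun.output_mem {x y : ℕ → Vec n} (hr : p.IsRun F P z x y) (hp : p.Admissible)
    (hP : IsDownClosedBody P) (hz : z ∈ P) : y p.m ∈ P := by
  have h := hr.iterateBounds hp hP hz le_rfl
  refine hP.down_closed _ ?_ _ fun j => ⟨(h.mem_cube j).1, h.le_sum j⟩
  refine hP.convex.sum_mem (fun _ _ => hp.step_pos.le) ?_
    fun k hk => hr.x_mem hP (Finset.mem_range.1 hk)
  rw [Finset.sum_const, Finset.card_range, nsmul_eq_mul, hp.m_mul_step]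

lemma exists_isRun (hp : p.Admissible) (hP : IsDownClosedBody P) (ho : o ∈ P) :
    ∃ x y : ℕ → Vec n, p.IsRun F P z x y := by
  have hm : 0 < p.m := by have := hp.three_le_m; omega
  have hX : ∀ (i : ℕ) (y : Vec n), ∃ x : Vec n,
      ((p.Q F P z i y).Nonempty → IsFrankWolfeOutput F (p.Q F P z i y) p.m x) ∧
      (¬ (p.Q F P z i y).Nonempty → x ∈ P) := by
    intro i y
    by_cases h : (p.Q F P z i y).Nonempty
    · obtain ⟨x, hx⟩ := exists_isFrankWolfeOutput F hm (isCompact_Q hP.compact i y) h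
      exact ⟨x, fun _ => hx, fun h' => absurd h h'⟩
    · exact ⟨o, fun h' => absurd h' h, fun _ => ho⟩
  choose X hX1 hX2 using hX
  let y : ℕ → Vec n := fun k => Nat.rec 0
    (fun i w => w + p.step • had (ones n - w - p.seed z i) (X i w)) k
  exact ⟨fun i => X (i - 1) (y (i - 1)), y, rfl, fun i _ h => hX1 i _ h, fun i _ h => hX2 i _ h,
    fun i _ => rfl⟩

/-! ### The comparator stays feasible -/

/-- Before the switch feasibility is unconditional. Afterwards it is proved by induction together
with a lower bound on F(y(i)⊕o). The bound on F(x(i+1)⊕o) is demanded only where o is already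
feasible, so that its failure makes o a competitor in that very subroutine call. -/
lemma IsRun.mem_Q {x y : ℕ → Vec n} (hr : p.IsRun F P z x y) (hp : p.Admissible)
    (hF0 : ∀ x ∈ cube n, 0 ≤ F x) (hd : DifferentiableOn ℝ F (cube n)) (hF : IsWeaklyDR p.γ F)
    (hP : IsDownClosedBody P) (hz : z ∈ P) (ho : o ∈ P) (hv : p.ValidSurrogates F z o)
    (hx : ∀ i < p.m, o ∈ p.Q F P z i (y i) → F (psum z o) - p.ε * F o ≤ F (psum (x (i + 1)) o))
    {i : ℕ} (hi : i < p.m) : o ∈ p.Q F P z i (y i) := by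
  have hzc := hP.subset_cube hz
  have hoc := hP.subset_cube ho
  have hb0 := hp.one_sub_β_pos
  have hb1 : 1 - p.β < 1 := by linarith [hp.β_pos]
  have hbh : p.γ = 1 → 1 - p.β = 1 - p.step := fun h1 => by
    rw [hp.one_sub_β, h1]; simp
  have hphase1 : ∀ i, i ≤ p.iS → (1 - p.β) ^ i * F o
      + (1 - (1 - p.β) ^ i) / p.γ * (F o - F (psum z o)) ≤ F (psum (y i) o) := fun i hi' => by
    have hb := hr.iterateBounds hp hP hz (hi'.trans hp.iS_le)
    exact hF.psum_lower_of_disjoint hd hp.γ_pos hp.γ_le hF0 hb0 hb1 hbh hb.mem_cube hzc hoc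
      (hb.pow_mul_le hi')
  have hb := hr.iterateBounds hp hP hz hi.le
  rcases lt_or_ge i p.iS with hlt | hge
  · have es : p.seed z i = z := by rw [seed, if_pos hlt]
    refine mem_Q_of_v_le hF hd hp.γ_pos ho hoc hb.mem_cube (seed_nonneg hzc i)
      (hb.add_seed_le hp hzc) ?_
    have h1 := hphase1 i hlt.le
    have h2 := hF.psum_sub_le hp.γ_pos hF0 hb.mem_cube hzc hoc
      (fun j => by have := hb.add_seed_le hp hzc j; rwa [es] at this)
    have h3 := hp.v₁_le hv i
    rw [v, if_pos hlt, es]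
    linarith
  · have hphase2 : ∀ k, p.iS + k < p.m → (1 - p.β) ^ (p.iS + k) * (F o
        + (((1 - p.β) ^ p.iS)⁻¹ - 1) / p.γ * (F o - F (psum z o))
        + k * (p.β / (1 - p.β)) * (F (psum z o) - p.ε * F o)) ≤ F (psum (y (p.iS + k)) o) →
        o ∈ p.Q F P z (p.iS + k) (y (p.iS + k)) := by
      intro k hk h
      have es : p.seed z (p.iS + k) = 0 := by rw [seed, if_neg (by omega)]
      have hb := hr.iterateBounds hp hP hz hk.le
      refine mem_Q_of_v_le hF hd hp.γ_pos ho hoc hb.mem_cube (seed_nonneg hzc _)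
        (hb.add_seed_le hp hzc) ?_
      have e : y (p.iS + k) + had (ones n - y (p.iS + k) - 0) o = psum (y (p.iS + k)) o := by
        ext j; simp; ring
      rw [v, if_neg (by omega), es, e]
      exact (hp.v₂_le hv (hF0 _ (psum_mem_cube hzc hoc)) hk).trans h
    have hlower : ∀ k, p.iS + k ≤ p.m → (1 - p.β) ^ (p.iS + k) * (F o
        + (((1 - p.β) ^ p.iS)⁻¹ - 1) / p.γ * (F o - F (psum z o))
        + k * (p.β / (1 - p.β)) * (F (psum z o) - p.ε * F o)) ≤ F (psum (y (p.iS + k)) o) := by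
      intro k
      induction k with
      | zero =>
        intro _
        -- At the switch the two lower bounds coincide: b^iS (b^(-iS) - 1) = 1 - b^iS.
        refine le_trans (le_of_eq ?_) (hphase1 p.iS le_rfl)
        have := (pow_pos hb0 p.iS).ne'
        have := hp.γ_pos.ne'
        simp only [Nat.cast_zero, zero_mul, add_zero]
        field_simp
      | succ k ih =>
        intro hk
        have hk' : p.iS + k < p.m := by omega
        have hprev := ih hk'.le
        have hoQ := hphase2 k hk' hprev
        have hb := hr.iterateBounds hp hP hz hk'.le
        have hxc := hP.subset_cube (hr.x_mem hP hk')
        have hx' := hx _ hk' hoQ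
        have h1 := hF.pow_mul_le_psum hd hp.γ_le hF0 hb0 hb1 hbh hb.mem_cube
          (psum_mem_cube hxc hoc) hb.pow_le
        have h2 := hF.psum_step hd hp.γ_pos hp.step_pos.le (by linarith [hp.step_le_third])
          hb.mem_cube hxc hoc
        have es : p.seed z (p.iS + k) = 0 := by rw [seed, if_neg (by omega)]
        have ey : y (p.iS + (k + 1)) = y (p.iS + k)
            + p.step • had (ones n - y (p.iS + k)) (x (p.iS + k + 1)) := by
          have := hr.update_y _ hk'
          rw [es, sub_zero] at this
          exact this
        rw [← ey] at h2
        have hden := hp.denom_pos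
        have h3 : (1 - p.β) * F (psum (y (p.iS + k)) o)
            + p.β * F (psum (y (p.iS + k)) (psum (x (p.iS + k + 1)) o))
            ≤ F (psum (y (p.iS + (k + 1))) o) := by
          rw [hp.one_sub_β, β, div_mul_eq_mul_div, div_mul_eq_mul_div, ← add_div,
            div_le_iff₀ hden]
          linarith
        refine le_trans ?_ h3
        have h4 := mul_le_mul_of_nonneg_left hprev hb0.le
        have h5 := mul_le_mul_of_nonneg_left
          ((mul_le_mul_of_nonneg_left hx' (pow_pos hb0 (p.iS + k)).le).trans h1) hp.β_pos.le
        refine le_trans (le_of_eq ?_) (add_le_add h4 h5)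
        -- The new term carries β b^i; factoring out b^(i+1) produces the slope β/(1-β).
        have e : (1 - p.β) * (p.β / (1 - p.β)) = p.β := mul_div_cancel₀ _ hb0.ne'
        rw [← add_assoc, pow_succ]
        push_cast
        linear_combination ((1 - p.β) ^ (p.iS + k) * (F (psum z o) - p.ε * F o)) * e
    obtain ⟨k, rfl⟩ := Nat.exists_eq_add_of_le hge
    exact hphase2 k hi (hlower k hi.le)

end Params

namespace Params

variable {n : ℕ} {p : Params} {F : Vec n → ℝ} {P : Set (Vec n)} {z o : Vec n}

/-! ### Progress of a run -/

/-- The first-order term of the update is the step times ⟨w, x⟩, which membership in Q bounds below.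
The direction is no longer than x = x - 0, hence than D, because 0 ∈ P. -/
lemma IsRun.progress {L : ℝ} {x y : ℕ → Vec n} (hr : p.IsRun F P z x y) (hp : p.Admissible)
    (hF : IsSmooth L F) (hP : IsDownClosedBody P) (hz : z ∈ P)
    {i : ℕ} (hi : i < p.m) (hne : (p.Q F P z i (y i)).Nonempty) :
    (1 - p.step * p.γ) * F (y i) + p.step * (p.γ * p.v i)
      - p.step ^ 2 * (L * Metric.diam P ^ 2) / 2 ≤ F (y (i + 1)) := by
  have hzc := hP.subset_cube hz
  have hb := hr.iterateBounds hp hP hz hi.le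
  have hb' := hr.iterateBounds hp hP hz (i := i + 1) hi
  have hxQ := (hr.choose_x i hi hne).mem (convex_Q hP.convex _ _) (by omega)
  have hw : ones n - y i - p.seed z i ∈ cube n := fun j => by
    have h1 := hb.add_seed_le hp hzc j
    have h2 := (hb.mem_cube j).1
    have h3 := seed_nonneg (p := p) hzc i j
    simp only [PiLp.sub_apply, ones_apply]
    constructor <;> linarith
  have h1 := hF.descent hb.mem_cube (d := p.step • had (ones n - y i - p.seed z i) (x (i + 1)))
    (by rw [← hr.update_y i hi]; exact hb'.mem_cube)
  rw [← hr.update_y i hi, real_inner_smul_left, norm_smul, mul_pow,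
    Real.norm_of_nonneg hp.step_pos.le, inner_had_left] at h1
  have h2 := hxQ.2
  rw [weight] at h2
  have h3 := hF.sq_norm_le_diam hP hxQ.1 (hP.zero_mem hz)
    (w := had (ones n - y i - p.seed z i) (x (i + 1))) (by rw [sub_zero]; exact norm_had_le hw)
  have h4 := mul_le_mul_of_nonneg_left h2 hp.step_pos.le
  have h5 := mul_le_mul_of_nonneg_left h3 (sq_nonneg p.step)
  linarith

lemma IsRun.sum_le_output {L : ℝ} {x y : ℕ → Vec n} (hr : p.IsRun F P z x y) (hp : p.Admissible)
    (hF0 : ∀ x ∈ cube n, 0 ≤ F x) (hF : IsSmooth L F) (hP : IsDownClosedBody P) (hz : z ∈ P)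
    (hne : ∀ i < p.m, (p.Q F P z i (y i)).Nonempty) :
    ∑ i ∈ Finset.range p.m, p.step * (1 - p.step * p.γ) ^ (p.m - 1 - i) * (p.γ * p.v i)
      - p.step * (L * Metric.diam P ^ 2) / 2 ≤ F (y p.m) := by
  have hr0 : 0 ≤ 1 - p.step * p.γ := by
    have := mul_le_of_le_one_right hp.step_pos.le hp.γ_le
    linarith [hp.step_le_third]
  have hr1 : 1 - p.step * p.γ ≤ 1 := by
    have := mul_pos hp.step_pos hp.γ_pos
    linarith
  have hD := hF.diam_nonneg hP hz
  have key : ∀ k, k ≤ p.m →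
      ∑ i ∈ Finset.range k, p.step * (1 - p.step * p.γ) ^ (k - 1 - i) * (p.γ * p.v i)
        - k * (p.step ^ 2 * (L * Metric.diam P ^ 2) / 2) ≤ F (y k) := by
    intro k
    induction k with
    | zero => intro _; simpa [hr.init] using hF0 0 (zero_mem_cube n)
    | succ k ih =>
      intro hk
      have h1 := hr.progress hp hF hP hz (i := k) hk (hne k hk)
      have h2 := mul_le_mul_of_nonneg_left (ih (by omega)) hr0
      have e : ∑ i ∈ Finset.range k, p.step * (1 - p.step * p.γ) ^ (k + 1 - 1 - i) * (p.γ * p.v i)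
          = (1 - p.step * p.γ)
            * ∑ i ∈ Finset.range k, p.step * (1 - p.step * p.γ) ^ (k - 1 - i) * (p.γ * p.v i) := by
        rw [Finset.mul_sum]
        refine Finset.sum_congr rfl fun i hi => ?_
        have : k + 1 - 1 - i = (k - 1 - i) + 1 := by have := Finset.mem_range.1 hi; omega
        rw [this, pow_succ]; ring
      rw [Finset.sum_range_succ, e]
      have e2 : k + 1 - 1 - k = 0 := by omega
      rw [e2, pow_zero, mul_one]
      have h3 : (1 - p.step * p.γ) * (k * (p.step ^ 2 * (L * Metric.diam P ^ 2) / 2))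
          ≤ k * (p.step ^ 2 * (L * Metric.diam P ^ 2) / 2) :=
        mul_le_of_le_one_left (by positivity) hr1
      push_cast
      linarith
  have := key p.m le_rfl
  have e : (p.m : ℝ) * (p.step ^ 2 * (L * Metric.diam P ^ 2) / 2)
      = p.step * (L * Metric.diam P ^ 2) / 2 := by
    linear_combination (p.step * (L * Metric.diam P ^ 2) / 2) * hp.m_mul_step
  linarith

/-- Both thresholds, multiplied by `γ`, in terms of the exact values of `F`. -/
lemma Admissible.le_γ_mul_v (hp : p.Admissible) (hv : p.ValidSurrogates F z o)
    {i : ℕ} (hi : i < p.m) :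
    ((1 - p.β) ^ (i - p.iS) - (1 - p.γ) * (1 - p.β) ^ i) * F o
      - (if i < p.iS then 1 else 0) * F (had z o)
      - ((1 - p.β) ^ (i - p.iS) - (1 - p.β) ^ i
          - p.γ * p.β * (i - p.iS : ℕ) * (1 - p.β) ^ i) * F (psum z o)
      - 8 * p.ε * F o ≤ p.γ * p.v i := by
  have hb0 := hp.one_sub_β_pos
  have hb1 : 1 - p.β ≤ 1 := by linarith [hp.β_pos]
  have hbi : (1 - p.β) ^ i ≤ 1 := pow_le_one₀ hb0.le hb1
  have hbi0 : 0 < (1 - p.β) ^ i := pow_pos hb0 i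
  obtain ⟨h1, h2, h3, h4, h5, h6⟩ := hv
  have hγ := hp.γ_pos
  have hγ1 := hp.γ_le
  have hε := hp.ε_pos
  have hFo : 0 ≤ F o := nonneg_of_mul_nonneg_right (a := p.ε) (by linarith) hε
  have hg0 : 0 ≤ p.g := by nlinarith [hp.ε_lt]
  have hεg : p.ε * p.g ≤ p.ε * F o := mul_le_mul_of_nonneg_left h2 hε.le
  have hεF : 0 ≤ p.ε * F o := mul_nonneg hε.le hFo
  have hεg0 : 0 ≤ p.ε * p.g := mul_nonneg hε.le hg0
  rcases lt_or_ge i p.iS with hlt | hge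
  -- Truncated subtraction lets one formula cover both phases: `i - p.iS` is 0 before the switch.
  · have e1 : i - p.iS = 0 := by omega
    rw [v, if_pos hlt, if_pos hlt, v₁, e1, pow_zero, Nat.cast_zero]
    set c := (1 - p.β) ^ i
    have e2 : p.γ * ((c + (1 - c - 2 * p.ε) / p.γ) * p.g - 1 / p.γ * p.gOdot
        - (1 - c) / p.γ * p.gOplus)
        = (1 - (1 - p.γ) * c) * p.g - 2 * (p.ε * p.g) - p.gOdot - (1 - c) * p.gOplus := by
      field_simp; ring
    rw [e2]
    have a0 : 0 ≤ (1 - p.γ) * c := mul_nonneg (by linarith) hbi0.le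
    have a0' : 0 ≤ 1 - (1 - p.γ) * c := by nlinarith
    have a1 := mul_le_mul_of_nonneg_left h1 a0'
    have a2 := mul_le_mul_of_nonneg_left h6 (sub_nonneg.2 hbi)
    have a3 := mul_nonneg a0 hεF
    linarith
  · obtain ⟨k, rfl⟩ := Nat.exists_eq_add_of_le hge
    have hB3 := hp.inv_pow_le (i := p.iS) (by omega)
    have hB1 : 1 ≤ ((1 - p.β) ^ p.iS)⁻¹ :=
      (one_le_inv₀ (pow_pos hb0 _)).2 (pow_le_one₀ hb0.le hb1)
    have hk1 : (k : ℝ) * p.β ≤ 1 := by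
      refine le_trans ?_ (hp.mul_β_div_le (k := k) (by omega))
      refine mul_le_mul_of_nonneg_left ?_ (Nat.cast_nonneg _)
      rw [le_div_iff₀ hb0]
      nlinarith [hp.β_pos]
    have hk0 : 0 ≤ (k : ℝ) * p.β := mul_nonneg (Nat.cast_nonneg _) hp.β_pos.le
    have hnb : ¬ (p.iS + k < p.iS) := by omega
    rw [v, if_neg hnb, if_neg hnb, v₂, Nat.add_sub_cancel_left]
    have e : ((p.iS + k : ℕ) : ℝ) - p.iS = k := by push_cast; ring
    have ek : (1 - p.β) ^ k = (1 - p.β) ^ (p.iS + k) * ((1 - p.β) ^ p.iS)⁻¹ := by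
      rw [pow_add]
      have := (pow_pos hb0 p.iS).ne'
      field_simp
    rw [e, ek]
    set B := ((1 - p.β) ^ p.iS)⁻¹
    set c := (1 - p.β) ^ (p.iS + k)
    rw [mul_comm (k : ℝ)] at hk0 hk1
    have e2 : p.γ * (c * ((B / p.γ - (1 + 3 / p.γ) * p.ε + 1 - 1 / p.γ) * p.g
          - (B / p.γ - 1 / p.γ - p.β * k) * p.gOplus))
        = c * ((B - (1 - p.γ)) * p.g - (p.γ + 3) * (p.ε * p.g)
          - (B - 1 - p.γ * (p.β * k)) * p.gOplus) := by
      field_simp; ring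
    rw [e2]
    set κ := p.β * (k : ℝ) with hκ
    have hγκ0 : 0 ≤ p.γ * κ := mul_nonneg hγ.le hk0
    have hγκ1 : p.γ * κ ≤ 1 := mul_le_one₀ hγ1 hk0 hk1
    have a1 : (B - (1 - p.γ)) * ((1 - p.ε) * F o) ≤ (B - (1 - p.γ)) * p.g :=
      mul_le_mul_of_nonneg_left h1 (by linarith)
    have a2 : (B - 1 - p.γ * κ) * (p.gOplus - F (psum z o)) ≤ p.ε * F o := by
      rcases le_total 0 (B - 1 - p.γ * κ) with hK | hK
      · have := mul_nonpos_of_nonneg_of_nonpos hK (sub_nonpos.2 h6)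
        linarith
      · nlinarith
    have a3 : (B - (1 - p.γ)) * (p.ε * F o) ≤ 3 * (p.ε * F o) :=
      mul_le_mul_of_nonneg_right (by linarith) hεF
    have a4 : (p.γ + 3) * (p.ε * p.g) ≤ 4 * (p.ε * F o) := by nlinarith
    -- Here 8 = 3 + 4 + 1: replacing g by F(o) with B ≤ 3, the explicit reserve (γ + 3)εg, and the
    -- error of g_⊕, which matters only when its coefficient is negative and then has size at most
    -- 1.
    have a5 : (B - (1 - p.γ)) * F o - (B - 1 - p.γ * κ) * F (psum z o) - 8 * (p.ε * F o)
        ≤ (B - (1 - p.γ)) * p.g - (p.γ + 3) * (p.ε * p.g) - (B - 1 - p.γ * κ) * p.gOplus := by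
      linarith
    have a6 := mul_le_mul_of_nonneg_left a5 hbi0.le
    have a7 : c * (8 * (p.ε * F o)) ≤ 8 * (p.ε * F o) :=
      mul_le_of_le_one_left (by positivity) hbi
    have e3 : p.γ * p.β * (k : ℝ) = p.γ * κ := by rw [hκ]; ring
    rw [e3]
    linarith

end Params

/-! ### The coefficients as integrals -/

/-- The integrand of `coefA`. -/
noncomputable def integrandA (γ T t : ℝ) : ℝ :=
  Real.exp (-(γ * (1 - t)))
    * (Real.exp (-(γ ^ 2 * max (t - T) 0)) - (1 - γ) * Real.exp (-(γ ^ 2 * t)))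

/-- The negative of the integrand of `coefC`. -/
noncomputable def integrandC (γ T t : ℝ) : ℝ :=
  Real.exp (-(γ * (1 - t)))
    * (Real.exp (-(γ ^ 2 * max (t - T) 0)) - Real.exp (-(γ ^ 2 * t))
      - γ ^ 3 * max (t - T) 0 * Real.exp (-(γ ^ 2 * t)))

lemma continuous_integrandA (γ T : ℝ) : Continuous (integrandA γ T) := by
  unfold integrandA; fun_prop

lemma continuous_integrandC (γ T : ℝ) : Continuous (integrandC γ T) := by
  unfold integrandC; fun_prop

lemma integral_eq_sub_add_sub {f Φ Ψ : ℝ → ℝ} (hf : Continuous f) {T : ℝ} (hT0 : 0 ≤ T)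
    (hT1 : T ≤ 1) (hΦ : ∀ t ≤ T, HasDerivAt Φ (f t) t) (hΨ : ∀ t, T ≤ t → HasDerivAt Ψ (f t) t) :
    ∫ t in (0 : ℝ)..1, f t = (Φ T - Φ 0) + (Ψ 1 - Ψ T) := by
  rw [← intervalIntegral.integral_add_adjacent_intervals (hf.intervalIntegrable 0 T)
    (hf.intervalIntegrable T 1)]
  congr 1
  · refine intervalIntegral.integral_eq_sub_of_hasDerivAt (fun t ht => hΦ t ?_)
      (hf.intervalIntegrable 0 T)
    rw [Set.uIcc_of_le hT0] at ht
    exact ht.2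
  · refine intervalIntegral.integral_eq_sub_of_hasDerivAt (fun t ht => hΨ t ?_)
      (hf.intervalIntegrable T 1)
    rw [Set.uIcc_of_le hT1] at ht
    exact ht.1

lemma hasDerivAt_exp_const_mul (c t : ℝ) :
    HasDerivAt (fun s => Real.exp (c * s)) (c * Real.exp (c * t)) t := by
  have := ((hasDerivAt_id t).const_mul c).exp
  simpa [mul_comm] using this

/-- The maximum splits the integral at T. Beyond T the integrand is a multiple of exp(γ(1-γ)t),
which is constant at γ = 1; this is why that case needs its own antiderivative there. -/
lemma integral_integrandA {γ T : ℝ} (hγ0 : 0 < γ) (hT0 : 0 ≤ T) (hT1 : T ≤ 1) :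
    ∫ t in (0 : ℝ)..1, integrandA γ T t = coefA γ T := by
  have hΦ : ∀ t ≤ T, HasDerivAt (fun s => Real.exp (-γ)
      * (Real.exp (γ * s) / γ - Real.exp (γ * (1 - γ) * s) / γ)) (integrandA γ T t) t := by
    intro t ht
    refine ((((hasDerivAt_exp_const_mul γ t).div_const γ).sub
      ((hasDerivAt_exp_const_mul (γ * (1 - γ)) t).div_const γ)).const_mul _).congr_deriv ?_
    rw [integrandA, max_eq_right (by linarith), show -(γ * (1 - t)) = -γ + γ * t by ring,
      show γ * (1 - γ) * t = γ * t + -(γ ^ 2 * t) by ring, Real.exp_add, Real.exp_add]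
    simp only [mul_zero, neg_zero, Real.exp_zero]
    field_simp
  by_cases h1 : γ = 1
  · subst h1
    rw [integral_eq_sub_add_sub (continuous_integrandA 1 T) hT0 hT1 hΦ
      (Ψ := fun s => Real.exp (-1) * Real.exp T * s) fun t ht => ?_]
    · rw [coefA, if_pos rfl, show T - 1 = -1 + T by ring, Real.exp_add]
      simp
      ring
    · refine ((hasDerivAt_id t).const_mul _).congr_deriv ?_
      rw [integrandA, max_eq_left (by linarith), ← Real.exp_add]
      simp only [sub_self, zero_mul, sub_zero, ← Real.exp_add, mul_one]
      ring_nf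
  · have h1' : 1 - γ ≠ 0 := sub_ne_zero.2 (Ne.symm h1)
    rw [integral_eq_sub_add_sub (continuous_integrandA γ T) hT0 hT1 hΦ
      (Ψ := fun s => Real.exp (-γ) * (Real.exp (γ ^ 2 * T) - (1 - γ))
        * (Real.exp (γ * (1 - γ) * s) / (γ * (1 - γ)))) fun t ht => ?_]
    · rw [coefA, if_neg h1, formulaA, show γ * T - γ = γ * T + -γ by ring,
        show γ * (1 - γ) * T = γ * T + -(γ ^ 2 * T) by ring,
        show γ * (1 - γ) * 1 = γ + -γ ^ 2 by ring]
      simp only [Real.exp_add, Real.exp_neg, mul_zero, Real.exp_zero]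
      have a1 := Real.exp_ne_zero γ
      have a2 := Real.exp_ne_zero (γ ^ 2 * T)
      have a3 := Real.exp_ne_zero (γ ^ 2)
      field_simp
      ring
    · refine (((hasDerivAt_exp_const_mul (γ * (1 - γ)) t).div_const _).const_mul _).congr_deriv ?_
      rw [integrandA, max_eq_left (by linarith), show -(γ * (1 - t)) = γ * t + -γ by ring,
        show -(γ ^ 2 * (t - T)) = γ ^ 2 * T + -(γ ^ 2 * t) by ring,
        show γ * (1 - γ) * t = γ * t + -(γ ^ 2 * t) by ring]
      simp only [Real.exp_add]
      field_simp

/-- Beyond T the factor t - T is integrated by parts against exp(γ(1-γ)t), whence the squared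
denominator; at γ = 1 it becomes a quadratic polynomial. -/
lemma integral_integrandC {γ T : ℝ} (hγ0 : 0 < γ) (hT0 : 0 ≤ T) (hT1 : T ≤ 1) :
    ∫ t in (0 : ℝ)..1, integrandC γ T t = -coefC γ T := by
  by_cases h1 : γ = 1
  · subst h1
    rw [integral_eq_sub_add_sub (continuous_integrandC 1 T) hT0 hT1
      (Φ := fun s => Real.exp (-1) * (Real.exp (1 * s) - s))
      (Ψ := fun s => Real.exp (-1) * ((Real.exp T - 1) * s - (s - T) ^ 2 / 2))
      (fun t ht => ?_) fun t ht => ?_]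
    · rw [coefC, if_pos rfl, show T - 1 = -1 + T by ring, Real.exp_add]
      simp
      ring
    · refine (((hasDerivAt_exp_const_mul 1 t).sub (hasDerivAt_id t)).const_mul _).congr_deriv ?_
      rw [integrandC, max_eq_right (by linarith), show -(1 * (1 - t)) = -1 + 1 * t by ring,
        show -((1 : ℝ) ^ 2 * t) = -t by ring, Real.exp_add, Real.exp_neg t]
      have := Real.exp_ne_zero t
      simp only [mul_zero, neg_zero, Real.exp_zero, one_mul, zero_mul, sub_zero]
      field_simp
    · refine ((((hasDerivAt_id t).const_mul _).sub
        ((((hasDerivAt_id t).sub_const T).pow 2).div_const 2)).const_mul _).congr_deriv ?_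
      rw [integrandC, max_eq_left (by linarith), show -(1 * (1 - t)) = -1 + t by ring,
        show -((1 : ℝ) ^ 2 * t) = -t by ring,
        show -((1 : ℝ) ^ 2 * (t - T)) = T + -t by ring]
      simp only [Real.exp_add, Real.exp_neg t]
      have := Real.exp_ne_zero t
      simp
      field_simp
  · have h1' : 1 - γ ≠ 0 := sub_ne_zero.2 (Ne.symm h1)
    rw [integral_eq_sub_add_sub (continuous_integrandC γ T) hT0 hT1
      (Φ := fun s => Real.exp (-γ)
        * (Real.exp (γ * s) / γ - Real.exp (γ * (1 - γ) * s) / (γ * (1 - γ))))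
      (Ψ := fun s => Real.exp (-γ) * (Real.exp (γ * (1 - γ) * s)
        * ((Real.exp (γ ^ 2 * T) - 1) / (γ * (1 - γ))
          - γ ^ 3 * ((s - T) / (γ * (1 - γ)) - 1 / (γ * (1 - γ)) ^ 2))))
      (fun t ht => ?_) fun t ht => ?_]
    · rw [coefC, if_neg h1, formulaC,
        show -γ * (1 - T) - γ ^ 2 * T = γ * T + -γ + -(γ ^ 2 * T) by ring,
        show γ * (1 - γ) * (1 - T) = γ + -γ ^ 2 + -(γ * T) + γ ^ 2 * T by ring,
        show -γ * (1 - T) = γ * T + -γ by ring,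
        show -γ ^ 2 * T = -(γ ^ 2 * T) by ring, show -γ * T = -(γ * T) by ring,
        show γ * (1 - γ) * T = γ * T + -(γ ^ 2 * T) by ring,
        show γ * (1 - γ) * 1 = γ + -γ ^ 2 by ring]
      simp only [Real.exp_add, Real.exp_neg, mul_zero, Real.exp_zero]
      have a1 := Real.exp_ne_zero γ
      have a2 := Real.exp_ne_zero (γ ^ 2 * T)
      have a3 := Real.exp_ne_zero (γ ^ 2)
      have a4 := Real.exp_ne_zero (γ * T)
      field_simp
      ring
    · refine ((((hasDerivAt_exp_const_mul γ t).div_const γ).sub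
        ((hasDerivAt_exp_const_mul (γ * (1 - γ)) t).div_const _)).const_mul _).congr_deriv ?_
      rw [integrandC, max_eq_right (by linarith), show -(γ * (1 - t)) = -γ + γ * t by ring,
        show γ * (1 - γ) * t = γ * t + -(γ ^ 2 * t) by ring, Real.exp_add, Real.exp_add]
      simp only [mul_zero, neg_zero, Real.exp_zero, zero_mul, sub_zero]
      field_simp
    · refine (((hasDerivAt_exp_const_mul (γ * (1 - γ)) t).mul
        (((((hasDerivAt_id t).sub_const T).div_const (γ * (1 - γ))).sub_const
          (1 / (γ * (1 - γ)) ^ 2)).const_mul (γ ^ 3) |>.const_sub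
          ((Real.exp (γ ^ 2 * T) - 1) / (γ * (1 - γ))))).const_mul _).congr_deriv ?_
      rw [integrandC, max_eq_left (by linarith), show -(γ * (1 - t)) = γ * t + -γ by ring,
        show -(γ ^ 2 * (t - T)) = γ ^ 2 * T + -(γ ^ 2 * t) by ring,
        show γ * (1 - γ) * t = γ * t + -(γ ^ 2 * t) by ring]
      simp only [Real.exp_add, id]
      field_simp
      ring

/-! ### Discretization errors -/

lemma abs_integral_sub_sum_le {f : ℝ → ℝ} (hf : Continuous f) {a : ℕ → ℝ} {m : ℕ} {h M : ℝ}
    (hh : 0 < h) (hm : (m : ℝ) * h = 1)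
    (hM : ∀ i < m, ∀ t, i * h ≤ t → t ≤ (i + 1) * h → |f t - a i| ≤ M) :
    |(∫ t in (0 : ℝ)..1, f t) - ∑ i ∈ Finset.range m, h * a i| ≤ M := by
  have e := intervalIntegral.sum_integral_adjacent_intervals (f := f)
    (μ := MeasureTheory.volume) (a := fun i : ℕ => (i : ℝ) * h) (n := m)
    fun k _ => hf.intervalIntegrable _ _
  simp only [Nat.cast_zero, zero_mul, hm] at e
  rw [← e, ← Finset.sum_sub_distrib]
  refine (Finset.abs_sum_le_sum_abs _ _).trans ?_
  have : ∀ i ∈ Finset.range m,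
      |(∫ t in ((i : ℕ) : ℝ) * h..((i + 1 : ℕ) : ℝ) * h, f t) - h * a i| ≤ M * h := by
    intro i hi
    have hle : (i : ℝ) * h ≤ ((i + 1 : ℕ) : ℝ) * h := by push_cast; linarith
    have e1 : h * a i = ∫ _ in ((i : ℕ) : ℝ) * h..((i + 1 : ℕ) : ℝ) * h, a i := by
      rw [intervalIntegral.integral_const, smul_eq_mul]; push_cast; ring
    rw [e1, ← intervalIntegral.integral_sub (hf.intervalIntegrable _ _)
      (continuous_const.intervalIntegrable _ _)]
    have := intervalIntegral.norm_integral_le_of_norm_le_const (f := fun t => f t - a i) (C := M)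
      (a := (i : ℝ) * h) (b := ((i + 1 : ℕ) : ℝ) * h) (fun t ht => by
        rw [Set.uIoc_of_le hle] at ht
        exact hM i (Finset.mem_range.1 hi) t ht.1.le (by have := ht.2; push_cast at this; exact this))
    rw [Real.norm_eq_abs] at this
    refine this.trans (le_of_eq ?_)
    have e2 : ((i + 1 : ℕ) : ℝ) * h - i * h = h := by push_cast; ring
    rw [e2, abs_of_pos hh]
  refine (Finset.sum_le_sum this).trans (le_of_eq ?_)
  rw [Finset.sum_const, Finset.card_range, nsmul_eq_mul]
  linear_combination M * hm

lemma abs_pow_sub_pow_le {a b : ℝ} (ha0 : 0 ≤ a) (ha1 : a ≤ 1) (hb0 : 0 ≤ b) (hb1 : b ≤ 1)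
    (k : ℕ) : |a ^ k - b ^ k| ≤ k * |a - b| := by
  induction k with
  | zero => simp
  | succ k ih =>
    have e : a ^ (k + 1) - b ^ (k + 1) = a * (a ^ k - b ^ k) + (a - b) * b ^ k := by ring
    rw [e]
    refine (abs_add_le _ _).trans ?_
    rw [abs_mul, abs_mul, abs_of_nonneg ha0, abs_of_nonneg (pow_nonneg hb0 k)]
    have h1 := mul_le_of_le_one_left (abs_nonneg (a ^ k - b ^ k)) ha1
    have h2 := mul_le_of_le_one_right (abs_nonneg (a - b)) (pow_le_one₀ hb0 hb1 (n := k))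
    push_cast
    linarith

lemma abs_exp_neg_sub_le {x y : ℝ} (hx : 0 ≤ x) (hy : 0 ≤ y) :
    |Real.exp (-x) - Real.exp (-y)| ≤ |x - y| := by
  wlog hxy : x ≤ y generalizing x y
  · rw [abs_sub_comm, abs_sub_comm x]
    exact this hy hx (le_of_not_ge hxy)
  have h1 : Real.exp (-y) ≤ Real.exp (-x) := Real.exp_le_exp.2 (by linarith)
  rw [abs_of_nonneg (by linarith), abs_of_nonpos (by linarith)]
  have h2 := Real.add_one_le_exp (x - y)
  have h3 : Real.exp (-y) = Real.exp (-x) * Real.exp (x - y) := by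
    rw [← Real.exp_add]; ring_nf
  have h4 : Real.exp (-x) ≤ 1 := Real.exp_le_one_iff.2 (by linarith)
  have h5 := Real.exp_pos (-x)
  rw [h3]
  nlinarith

lemma abs_one_sub_sub_exp_neg_le {x : ℝ} (hx0 : 0 ≤ x) (hx1 : x ≤ 1) :
    |1 - x - Real.exp (-x)| ≤ x ^ 2 := by
  have := Real.abs_exp_sub_one_sub_id_le (x := -x) (by rwa [abs_neg, abs_of_nonneg hx0])
  rw [abs_sub_comm]
  rw [neg_sq] at this
  convert this using 2
  ring

lemma abs_mul_sub_mul_le {a e X Y η θ : ℝ} (ha : |a| ≤ 1) (hY : |Y| ≤ 1) (h1 : |a - e| ≤ η)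
    (h2 : |X - Y| ≤ θ) : |e * Y - a * X| ≤ η + θ := by
  have e1 : e * Y - a * X = -((a - e) * Y + a * (X - Y)) := by ring
  rw [e1, abs_neg]
  refine (abs_add_le _ _).trans ?_
  rw [abs_mul, abs_mul]
  have a1 := mul_le_of_le_one_right (abs_nonneg (a - e)) hY
  have a2 := mul_le_of_le_one_left (abs_nonneg (X - Y)) ha
  linarith

/-! ### Comparison of the discrete weights of a run with the coefficients -/

namespace Params.Admissible

variable {p : Params} (hp : p.Admissible)

include hp

lemma abs_β_sub_le : |p.β - p.γ ^ 2 * p.step| ≤ 2 * p.γ ^ 2 * p.step ^ 2 := by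
  have h1 := hp.step_pos
  have h2 := hp.step_le_third
  have h3 := hp.γ_sq_le
  have h4 := pow_pos hp.γ_pos 2
  have hden := hp.denom_pos
  have e : p.β - p.γ ^ 2 * p.step
      = p.γ ^ 2 * p.step ^ 2 * (1 - p.γ ^ 2) / (1 - p.step + p.γ ^ 2 * p.step) := by
    rw [β]; field_simp; ring
  have h5 : 0 < p.γ ^ 2 * p.step ^ 2 := by positivity
  rw [e, abs_of_nonneg (div_nonneg (mul_nonneg h5.le (by linarith)) hden.le), div_le_iff₀ hden]
  have h6 : 1 / 2 ≤ 1 - p.step + p.γ ^ 2 * p.step := by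
    have := mul_pos h4 h1
    linarith
  nlinarith

/-- Per factor the error is at most 2γ²h² from β ≈ γ²h plus γ²h² from 1 - x ≈ exp(-x); at most 1/h
factors give 3γ²h. The shift of the time argument adds γ²η. -/
lemma abs_pow_β_sub_le {k : ℕ} (hk : k ≤ p.m) {s η : ℝ} (hs : 0 ≤ s)
    (hks : |k * p.step - s| ≤ η) :
    |(1 - p.β) ^ k - Real.exp (-(p.γ ^ 2 * s))| ≤ p.γ ^ 2 * (3 * p.step + η) := by
  have h1 := hp.step_pos
  have h2 := hp.step_le_third
  have h3 := hp.γ_sq_le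
  have h4 := pow_pos hp.γ_pos 2
  have hx0 : 0 ≤ p.γ ^ 2 * p.step := by positivity
  have hkm : (k : ℝ) * p.step ≤ 1 := by
    rw [← hp.m_mul_step]
    exact mul_le_mul_of_nonneg_right (by exact_mod_cast hk) h1.le
  have a1 := abs_pow_sub_pow_le hp.one_sub_β_pos.le (by linarith [hp.β_pos])
    (Real.exp_pos (-(p.γ ^ 2 * p.step))).le (Real.exp_le_one_iff.2 (by linarith)) k
  have a2 := abs_one_sub_sub_exp_neg_le hx0 (by nlinarith)
  have a3 : |1 - p.β - Real.exp (-(p.γ ^ 2 * p.step))| ≤ 3 * p.γ ^ 2 * p.step ^ 2 := by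
    have e : 1 - p.β - Real.exp (-(p.γ ^ 2 * p.step))
        = -(p.β - p.γ ^ 2 * p.step) + (1 - p.γ ^ 2 * p.step - Real.exp (-(p.γ ^ 2 * p.step))) := by
      ring
    rw [e]
    refine (abs_add_le _ _).trans ?_
    rw [abs_neg]
    have := hp.abs_β_sub_le
    have : (p.γ ^ 2 * p.step) ^ 2 ≤ p.γ ^ 2 * p.step ^ 2 := by
      have := mul_nonneg (mul_nonneg h4.le (sq_nonneg p.step)) (sub_nonneg.2 h3)
      nlinarith
    linarith
  have a4 : Real.exp (-(p.γ ^ 2 * p.step)) ^ k = Real.exp (-(p.γ ^ 2 * (k * p.step))) := by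
    rw [← Real.exp_nat_mul]; ring_nf
  rw [a4] at a1
  have a5 := abs_exp_neg_sub_le (x := p.γ ^ 2 * (k * p.step)) (y := p.γ ^ 2 * s)
    (by positivity) (by positivity)
  rw [← mul_sub, abs_mul, abs_of_pos h4] at a5
  have a6 := mul_le_mul_of_nonneg_left hks h4.le
  have a7 := mul_le_mul_of_nonneg_left a3 (Nat.cast_nonneg (α := ℝ) k)
  have a8 : (k : ℝ) * (3 * p.γ ^ 2 * p.step ^ 2) ≤ 3 * p.γ ^ 2 * p.step := by
    have := mul_le_mul_of_nonneg_left hkm (by positivity : 0 ≤ 3 * p.γ ^ 2 * p.step)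
    linarith
  have a9 := abs_sub_le ((1 - p.β) ^ k) (Real.exp (-(p.γ ^ 2 * (k * p.step))))
    (Real.exp (-(p.γ ^ 2 * s)))
  linarith

lemma rate_nonneg : 0 ≤ 1 - p.step * p.γ := by
  have := mul_le_of_le_one_right hp.step_pos.le hp.γ_le
  linarith [hp.step_le_third]

lemma rate_le_one : 1 - p.step * p.γ ≤ 1 := by
  have := mul_pos hp.step_pos hp.γ_pos
  linarith

lemma abs_rate_pow_sub_le {k : ℕ} (hk : k ≤ p.m) {s : ℝ} (hs : 0 ≤ s)
    (hks : |k * p.step - s| ≤ p.step) :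
    |(1 - p.step * p.γ) ^ k - Real.exp (-(p.γ * s))| ≤ 2 * p.γ * p.step := by
  have h1 := hp.step_pos
  have h2 := hp.step_le_third
  have h3 := hp.γ_le
  have h4 := hp.γ_pos
  have hx0 : 0 ≤ p.step * p.γ := by positivity
  have hkm : (k : ℝ) * p.step ≤ 1 := by
    rw [← hp.m_mul_step]
    exact mul_le_mul_of_nonneg_right (by exact_mod_cast hk) h1.le
  have a1 := abs_pow_sub_pow_le hp.rate_nonneg hp.rate_le_one
    (Real.exp_pos (-(p.step * p.γ))).le (Real.exp_le_one_iff.2 (by linarith)) k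
  have a2 := abs_one_sub_sub_exp_neg_le hx0 (by nlinarith)
  have a4 : Real.exp (-(p.step * p.γ)) ^ k = Real.exp (-(p.γ * (k * p.step))) := by
    rw [← Real.exp_nat_mul]; ring_nf
  rw [a4] at a1
  have a5 := abs_exp_neg_sub_le (x := p.γ * (k * p.step)) (y := p.γ * s)
    (by positivity) (by positivity)
  rw [← mul_sub, abs_mul, abs_of_pos h4] at a5
  have a6 := mul_le_mul_of_nonneg_left hks h4.le
  have a7 := mul_le_mul_of_nonneg_left a2 (Nat.cast_nonneg (α := ℝ) k)
  have a8 : (k : ℝ) * (p.step * p.γ) ^ 2 ≤ p.γ * p.step := by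
    have b1 := mul_le_mul_of_nonneg_left hkm (by positivity : 0 ≤ p.step * p.γ ^ 2)
    have b2 : p.step * p.γ ^ 2 ≤ p.γ * p.step := by nlinarith
    linarith
  have a9 := abs_sub_le ((1 - p.step * p.γ) ^ k) (Real.exp (-(p.γ * (k * p.step))))
    (Real.exp (-(p.γ * s)))
  linarith

/-- The discrete time after the switch is close to the continuous one. -/
lemma abs_sub_iS_mul_step_le {i : ℕ} {t : ℝ} (ht0 : i * p.step ≤ t)
    (ht1 : t ≤ (i + 1) * p.step) :
    |((i - p.iS : ℕ) : ℝ) * p.step - max (t - p.tS) 0| ≤ 2 * p.step := by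
  have h1 := hp.step_pos
  have h2 := hp.tS_le_iS
  have h3 := hp.iS_lt
  rcases lt_or_ge i p.iS with hlt | hge
  · have e : i - p.iS = 0 := by omega
    have h4 : (i : ℝ) + 1 ≤ p.iS := by exact_mod_cast hlt
    have h5 := mul_le_mul_of_nonneg_right h4 h1.le
    rw [e, Nat.cast_zero, zero_mul, zero_sub, abs_neg, abs_of_nonneg (le_max_right _ _)]
    exact max_le (by linarith) (by linarith)
  · have h4 : ((i : ℕ) : ℝ) * p.step = (p.iS : ℝ) * p.step + ((i - p.iS : ℕ) : ℝ) * p.step := by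
      rw [← add_mul, ← Nat.cast_add, Nat.add_sub_cancel' hge]
    have h5 : (0 : ℝ) ≤ ((i - p.iS : ℕ) : ℝ) * p.step := by positivity
    rw [max_eq_left (by linarith), abs_le]
    constructor <;> linarith

lemma abs_time_sub_le {i : ℕ} {t : ℝ} (ht0 : i * p.step ≤ t)
    (ht1 : t ≤ (i + 1) * p.step) : |(i : ℝ) * p.step - t| ≤ p.step := by
  have := hp.step_pos
  rw [abs_le]
  constructor <;> linarith

lemma abs_rate_pow_sub_exp_le {i : ℕ} (hi : i < p.m) {t : ℝ} (ht0 : i * p.step ≤ t)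
    (ht1 : t ≤ (i + 1) * p.step) :
    |(1 - p.step * p.γ) ^ (p.m - 1 - i) - Real.exp (-(p.γ * (1 - t)))| ≤ 2 * p.γ * p.step := by
  have e : ((p.m - 1 - i : ℕ) : ℝ) = p.m - (i + 1) := by
    rw [Nat.sub_sub, Nat.cast_sub (by omega)]; push_cast; ring
  have e2 : ((p.m - 1 - i : ℕ) : ℝ) * p.step = 1 - (i + 1) * p.step := by
    rw [e, sub_mul, hp.m_mul_step]
  have hpos : (0 : ℝ) ≤ ((p.m - 1 - i : ℕ) : ℝ) * p.step := by have := hp.step_pos; positivity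
  refine hp.abs_rate_pow_sub_le (by omega) (by linarith) ?_
  rw [e2, abs_le]
  constructor <;> linarith

/-- Here 11 = 2 + 5 + 4, from the rate, the power since the switch (time error 2h) and the power
since the start (time error h). -/
lemma coefA_sub_le : coefA p.γ p.tS - 11 * p.step ≤
    ∑ i ∈ Finset.range p.m, p.step * ((1 - p.step * p.γ) ^ (p.m - 1 - i)
      * ((1 - p.β) ^ (i - p.iS) - (1 - p.γ) * (1 - p.β) ^ i)) := by
  have h1 := hp.step_pos
  have hγ := hp.γ_pos
  have hγ1 := hp.γ_le
  have hγ2 := hp.γ_sq_le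
  have := abs_integral_sub_sum_le (continuous_integrandA p.γ p.tS) h1 hp.m_mul_step
    (a := fun i => (1 - p.step * p.γ) ^ (p.m - 1 - i)
      * ((1 - p.β) ^ (i - p.iS) - (1 - p.γ) * (1 - p.β) ^ i)) (M := 11 * p.step) ?_
  · rw [integral_integrandA hγ hp.tS_pos.le hp.tS_lt.le] at this
    linarith [(abs_le.1 this).2]
  · intro i hi t ht0 ht1
    have ht : 0 ≤ t := le_trans (by positivity) ht0
    have b1 := hp.abs_rate_pow_sub_exp_le hi ht0 ht1
    have b2 := hp.abs_pow_β_sub_le (k := i - p.iS) (by omega) (le_max_right (t - p.tS) 0)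
      (hp.abs_sub_iS_mul_step_le ht0 ht1)
    have b3 := hp.abs_pow_β_sub_le hi.le ht (hp.abs_time_sub_le ht0 ht1)
    have hmax : 0 ≤ max (t - p.tS) 0 := le_max_right _ _
    have c1 := Real.exp_pos (-(p.γ ^ 2 * max (t - p.tS) 0))
    have c2 := Real.exp_pos (-(p.γ ^ 2 * t))
    have c3 : Real.exp (-(p.γ ^ 2 * max (t - p.tS) 0)) ≤ 1 :=
      Real.exp_le_one_iff.2 (by have : 0 ≤ p.γ ^ 2 * max (t - p.tS) 0 := by positivity
                                linarith)
    have c4 : Real.exp (-(p.γ ^ 2 * t)) ≤ 1 :=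
      Real.exp_le_one_iff.2 (by have : 0 ≤ p.γ ^ 2 * t := by positivity
                                linarith)
    have d1 : |(1 - p.step * p.γ) ^ (p.m - 1 - i)| ≤ 1 := by
      rw [abs_of_nonneg (pow_nonneg hp.rate_nonneg _)]
      exact pow_le_one₀ hp.rate_nonneg hp.rate_le_one
    have d2 : |Real.exp (-(p.γ ^ 2 * max (t - p.tS) 0))
        - (1 - p.γ) * Real.exp (-(p.γ ^ 2 * t))| ≤ 1 := by
      rw [abs_le]
      constructor <;> nlinarith
    have d3 : |(1 - p.β) ^ (i - p.iS) - (1 - p.γ) * (1 - p.β) ^ i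
        - (Real.exp (-(p.γ ^ 2 * max (t - p.tS) 0)) - (1 - p.γ) * Real.exp (-(p.γ ^ 2 * t)))|
        ≤ 9 * p.step := by
      have e : (1 - p.β) ^ (i - p.iS) - (1 - p.γ) * (1 - p.β) ^ i
        - (Real.exp (-(p.γ ^ 2 * max (t - p.tS) 0)) - (1 - p.γ) * Real.exp (-(p.γ ^ 2 * t)))
        = ((1 - p.β) ^ (i - p.iS) - Real.exp (-(p.γ ^ 2 * max (t - p.tS) 0)))
          - (1 - p.γ) * ((1 - p.β) ^ i - Real.exp (-(p.γ ^ 2 * t))) := by ring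
      rw [e]
      refine (abs_sub _ _).trans ?_
      rw [abs_mul, abs_of_nonneg (by linarith : 0 ≤ 1 - p.γ)]
      have := mul_le_of_le_one_left (abs_nonneg ((1 - p.β) ^ i - Real.exp (-(p.γ ^ 2 * t))))
        (by linarith : 1 - p.γ ≤ 1)
      nlinarith
    refine (abs_mul_sub_mul_le d1 d2 b1 d3).trans ?_
    nlinarith

/-- Here 19 = 2 + 5 + 4 + 8, the last for the linear drift term. The factor γ in the error
compensates the bound F(z⊕o) ≤ 2F(o)/γ. -/
lemma sum_le_neg_coefC : ∑ i ∈ Finset.range p.m, p.step * ((1 - p.step * p.γ) ^ (p.m - 1 - i)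
      * ((1 - p.β) ^ (i - p.iS) - (1 - p.β) ^ i
          - p.γ * p.β * (i - p.iS : ℕ) * (1 - p.β) ^ i))
      ≤ -coefC p.γ p.tS + 19 * p.γ * p.step := by
  have h1 := hp.step_pos
  have hγ := hp.γ_pos
  have hγ1 := hp.γ_le
  have hγ2 := hp.γ_sq_le
  have hγ20 := pow_pos hγ 2
  have hγγ : p.γ ^ 2 ≤ p.γ := by nlinarith
  have := abs_integral_sub_sum_le (continuous_integrandC p.γ p.tS) h1 hp.m_mul_step
    (a := fun i => (1 - p.step * p.γ) ^ (p.m - 1 - i)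
      * ((1 - p.β) ^ (i - p.iS) - (1 - p.β) ^ i
          - p.γ * p.β * (i - p.iS : ℕ) * (1 - p.β) ^ i)) (M := 19 * p.γ * p.step) ?_
  · rw [integral_integrandC hγ hp.tS_pos.le hp.tS_lt.le] at this
    linarith [(abs_le.1 this).1]
  · intro i hi t ht0 ht1
    have ht : 0 ≤ t := le_trans (by positivity) ht0
    have ht1' : t ≤ 1 := by
      refine (ht1.trans ?_).trans_eq hp.m_mul_step
      exact mul_le_mul_of_nonneg_right (by exact_mod_cast hi) h1.le
    have b0 := hp.abs_sub_iS_mul_step_le ht0 ht1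
    have hτ0 : 0 ≤ max (t - p.tS) 0 := le_max_right _ _
    have hτt : max (t - p.tS) 0 ≤ t := max_le (by linarith [hp.tS_pos]) ht
    have b1 := hp.abs_rate_pow_sub_exp_le hi ht0 ht1
    have b2 := hp.abs_pow_β_sub_le (k := i - p.iS) (by omega) hτ0 b0
    have b3 := hp.abs_pow_β_sub_le hi.le ht (hp.abs_time_sub_le ht0 ht1)
    have b4 := abs_exp_neg_sub_le (x := p.γ ^ 2 * max (t - p.tS) 0) (y := p.γ ^ 2 * t)
      (by positivity) (by positivity)
    have c4 : Real.exp (-(p.γ ^ 2 * t)) ≤ 1 :=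
      Real.exp_le_one_iff.2 (by have : 0 ≤ p.γ ^ 2 * t := by positivity
                                linarith)
    have c5 : Real.exp (-(p.γ ^ 2 * t)) ≤ Real.exp (-(p.γ ^ 2 * max (t - p.tS) 0)) :=
      Real.exp_le_exp.2 (by have := mul_le_mul_of_nonneg_left hτt hγ20.le; linarith)
    have c6 := Real.exp_pos (-(p.γ ^ 2 * t))
    have hk0 : (0 : ℝ) ≤ ((i - p.iS : ℕ) : ℝ) := Nat.cast_nonneg _
    have hk1 : ((i - p.iS : ℕ) : ℝ) * p.step ≤ 1 := by
      rw [← hp.m_mul_step]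
      exact mul_le_mul_of_nonneg_right (by exact_mod_cast (by omega : i - p.iS ≤ p.m)) h1.le
    have hb0 := hp.one_sub_β_pos
    have hbi1 : (1 - p.β) ^ i ≤ 1 := pow_le_one₀ hb0.le (by linarith [hp.β_pos])
    have hbi0 : 0 < (1 - p.β) ^ i := pow_pos hb0 i
    have b5 := hp.abs_β_sub_le
    set k : ℝ := ((i - p.iS : ℕ) : ℝ)
    set τ := max (t - p.tS) 0
    set X := Real.exp (-(p.γ ^ 2 * τ))
    set Y := Real.exp (-(p.γ ^ 2 * t))
    have d1 : |(1 - p.step * p.γ) ^ (p.m - 1 - i)| ≤ 1 := by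
      rw [abs_of_nonneg (pow_nonneg hp.rate_nonneg _)]
      exact pow_le_one₀ hp.rate_nonneg hp.rate_le_one
    have d2 : |X - Y - p.γ ^ 3 * τ * Y| ≤ 1 := by
      rw [abs_of_nonneg (sub_nonneg.2 c5), abs_of_nonpos
        (by have := mul_le_mul_of_nonneg_left hτt hγ20.le; linarith)] at b4
      have a1 : p.γ ^ 3 * τ * Y ≤ 1 :=
        mul_le_one₀ (mul_le_one₀ (pow_le_one₀ hγ.le hγ1) hτ0 (hτt.trans ht1')) c6.le c4
      have a2 : 0 ≤ p.γ ^ 3 * τ * Y := by positivity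
      have a3 : p.γ ^ 2 * t ≤ 1 := mul_le_one₀ hγ2 ht ht1'
      have a4 : 0 ≤ p.γ ^ 2 * τ := by positivity
      rw [abs_le]
      constructor <;> linarith
    have d4 : |p.β * k - p.γ ^ 2 * τ| ≤ 4 * p.γ ^ 2 * p.step := by
      have e : p.β * k - p.γ ^ 2 * τ
          = k * (p.β - p.γ ^ 2 * p.step) + p.γ ^ 2 * (k * p.step - τ) := by ring
      rw [e]
      refine (abs_add_le _ _).trans ?_
      rw [abs_mul, abs_mul, abs_of_nonneg hk0, abs_of_pos hγ20]
      have a1 := mul_le_mul_of_nonneg_left b5 hk0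
      have a2 := mul_le_mul_of_nonneg_left b0 hγ20.le
      have a3 := mul_le_mul_of_nonneg_left hk1 (by positivity : 0 ≤ 2 * p.γ ^ 2 * p.step)
      linarith
    have d5 : |p.γ * p.β * k * (1 - p.β) ^ i - p.γ ^ 3 * τ * Y| ≤ 8 * p.γ ^ 2 * p.step := by
      have e : p.γ * p.β * k * (1 - p.β) ^ i - p.γ ^ 3 * τ * Y
          = p.γ * ((1 - p.β) ^ i * (p.β * k - p.γ ^ 2 * τ)
            + p.γ ^ 2 * τ * ((1 - p.β) ^ i - Y)) := by ring
      rw [e, abs_mul, abs_of_pos hγ]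
      refine (mul_le_of_le_one_left (abs_nonneg _) hγ1).trans ((abs_add_le _ _).trans ?_)
      rw [abs_mul, abs_mul, abs_of_pos hbi0, abs_of_nonneg (by positivity : 0 ≤ p.γ ^ 2 * τ)]
      have a1 := mul_le_of_le_one_left (abs_nonneg (p.β * k - p.γ ^ 2 * τ)) hbi1
      have a2 := mul_le_of_le_one_left (abs_nonneg ((1 - p.β) ^ i - Y))
        (mul_le_one₀ hγ2 hτ0 (hτt.trans ht1'))
      linarith
    have d3 : |(1 - p.β) ^ (i - p.iS) - (1 - p.β) ^ i - p.γ * p.β * k * (1 - p.β) ^ i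
        - (X - Y - p.γ ^ 3 * τ * Y)| ≤ 17 * p.γ ^ 2 * p.step := by
      have e : (1 - p.β) ^ (i - p.iS) - (1 - p.β) ^ i - p.γ * p.β * k * (1 - p.β) ^ i
        - (X - Y - p.γ ^ 3 * τ * Y) = ((1 - p.β) ^ (i - p.iS) - X)
          - (((1 - p.β) ^ i - Y) + (p.γ * p.β * k * (1 - p.β) ^ i - p.γ ^ 3 * τ * Y)) := by ring
      rw [e]
      refine (abs_sub _ _).trans ?_
      have := abs_add_le ((1 - p.β) ^ i - Y)
        (p.γ * p.β * k * (1 - p.β) ^ i - p.γ ^ 3 * τ * Y)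
      linarith
    refine (abs_mul_sub_mul_le d1 d2 b1 d3).trans ?_
    have := mul_le_mul_of_nonneg_right hγγ h1.le
    linarith

/-- The indicator jumps at the switch, so no continuous integrand is available; the geometric sum
telescopes and only its two end powers are approximated. Their errors carry γ, which absorbs the
division by γ. -/
lemma sum_le_neg_coefB : ∑ i ∈ Finset.range p.m, p.step * ((1 - p.step * p.γ) ^ (p.m - 1 - i)
      * (if i < p.iS then 1 else 0)) ≤ -coefB p.γ p.tS + 4 * p.step := by
  have h1 := hp.step_pos
  have hγ := hp.γ_pos
  have hγ1 := hp.γ_le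
  have htele : ∀ k, k ≤ p.m → p.γ * ∑ i ∈ Finset.range k,
      p.step * (1 - p.step * p.γ) ^ (p.m - 1 - i)
      = (1 - p.step * p.γ) ^ (p.m - k) - (1 - p.step * p.γ) ^ p.m := by
    intro k
    induction k with
    | zero => intro _; simp
    | succ k ih =>
      intro hk
      rw [Finset.sum_range_succ, mul_add, ih (by omega),
        show p.m - k = (p.m - (k + 1)) + 1 by omega,
        show p.m - 1 - k = p.m - (k + 1) by omega, pow_succ]
      ring
  have e : ∑ i ∈ Finset.range p.m, p.step * ((1 - p.step * p.γ) ^ (p.m - 1 - i)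
      * (if i < p.iS then 1 else 0))
      = ∑ i ∈ Finset.range p.iS, p.step * (1 - p.step * p.γ) ^ (p.m - 1 - i) := by
    rw [← Finset.sum_subset (Finset.range_mono hp.iS_le)]
    · exact Finset.sum_congr rfl fun i hi => by rw [if_pos (Finset.mem_range.1 hi), mul_one]
    · intro i _ hi
      rw [if_neg (by simpa using hi), mul_zero, mul_zero]
  have a1 := hp.abs_rate_pow_sub_le (k := p.m - p.iS) (by omega) (s := 1 - p.tS)
    (by linarith [hp.tS_lt]) (by
      rw [Nat.cast_sub hp.iS_le, sub_mul, hp.m_mul_step, abs_le]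
      constructor <;> linarith [hp.tS_le_iS, hp.iS_lt])
  have a2 := hp.abs_rate_pow_sub_le (k := p.m) le_rfl (s := 1) zero_le_one (by
      rw [hp.m_mul_step, sub_self, abs_zero]; exact h1.le)
  refine le_of_mul_le_mul_left ?_ hγ
  rw [e, htele _ hp.iS_le, coefB]
  have e2 : p.γ * (-((Real.exp (-p.γ) - Real.exp (p.γ * p.tS - p.γ)) / p.γ) + 4 * p.step)
      = Real.exp (-(p.γ * (1 - p.tS))) - Real.exp (-(p.γ * 1)) + 4 * p.γ * p.step := by
    rw [show -(p.γ * (1 - p.tS)) = p.γ * p.tS - p.γ by ring, mul_one]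
    field_simp
    ring
  rw [e2]
  linarith [(abs_le.1 a1).2, (abs_le.1 a2).1]

lemma sum_rate_le_one :
    ∑ i ∈ Finset.range p.m, p.step * (1 - p.step * p.γ) ^ (p.m - 1 - i) ≤ 1 := by
  refine (Finset.sum_le_sum fun i _ => mul_le_of_le_one_right hp.step_pos.le
    (pow_le_one₀ hp.rate_nonneg hp.rate_le_one)).trans_eq ?_
  rw [Finset.sum_const, Finset.card_range, nsmul_eq_mul, hp.m_mul_step]

end Params.Admissible

/-! ### Assembly of the approximation guarantee -/

namespace Params

variable {n : ℕ} {p : Params} {F : Vec n → ℝ} {P : Set (Vec n)} {z o : Vec n}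

/-- The approximation guarantee when the comparator is feasible in every iteration. -/
lemma IsRun.guarantee {L : ℝ} {x y : ℕ → Vec n} (hr : p.IsRun F P z x y) (hp : p.Admissible)
    (hF0 : ∀ x ∈ cube n, 0 ≤ F x) (hF : IsSmooth L F) (hdr : IsWeaklyDR p.γ F)
    (hP : IsDownClosedBody P) (hz : z ∈ P) (ho : o ∈ P) (hmax : IsMaxOn F P o)
    (hv : p.ValidSurrogates F z o) (hne : ∀ i < p.m, (p.Q F P z i (y i)).Nonempty) :
    (coefA p.γ p.tS - 61 * p.ε) * F o + coefB p.γ p.tS * F (had z o)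
      + coefC p.γ p.tS * F (psum z o) - p.δ * L * Metric.diam P ^ 2 ≤ F (y p.m) := by
  have hzc := hP.subset_cube hz
  have hoc := hP.subset_cube ho
  have h1 := hp.step_pos
  have hsum := hr.sum_le_output hp hF0 hF hP hz hne
  have hFo := hF0 o hoc
  have hodot0 := hF0 _ (had_mem_cube hzc hoc)
  have hG0 := hF0 _ (psum_mem_cube hzc hoc)
  have hodot : F (had z o) ≤ F o := hmax (hP.down_closed o ho _ fun j =>
    ⟨mul_nonneg (hzc j).1 (hoc j).1, mul_le_of_le_one_left (hoc j).1 (hzc j).2⟩)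
  have hG := hdr.mul_psum_le hp.γ_le hF0 hP hz ho hmax
  have hA := mul_le_mul_of_nonneg_right hp.coefA_sub_le hFo
  have hB := mul_le_mul_of_nonneg_right hp.sum_le_neg_coefB hodot0
  have hC := mul_le_mul_of_nonneg_right hp.sum_le_neg_coefC hG0
  have hεF : 0 ≤ 8 * p.ε * F o := mul_nonneg (by linarith [hp.ε_pos]) hFo
  have hE := mul_le_mul_of_nonneg_right hp.sum_rate_le_one hεF
  have hlow : ∑ i ∈ Finset.range p.m, p.step * (1 - p.step * p.γ) ^ (p.m - 1 - i)
      * (((1 - p.β) ^ (i - p.iS) - (1 - p.γ) * (1 - p.β) ^ i) * F o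
      - (if i < p.iS then 1 else 0) * F (had z o)
      - ((1 - p.β) ^ (i - p.iS) - (1 - p.β) ^ i
          - p.γ * p.β * (i - p.iS : ℕ) * (1 - p.β) ^ i) * F (psum z o)
      - 8 * p.ε * F o)
      ≤ ∑ i ∈ Finset.range p.m, p.step * (1 - p.step * p.γ) ^ (p.m - 1 - i) * (p.γ * p.v i) :=
    Finset.sum_le_sum fun i hi => mul_le_mul_of_nonneg_left
      (hp.le_γ_mul_v hv (Finset.mem_range.1 hi))
      (mul_nonneg h1.le (pow_nonneg hp.rate_nonneg _))
  have hsplit : ∑ i ∈ Finset.range p.m, p.step * (1 - p.step * p.γ) ^ (p.m - 1 - i)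
      * (((1 - p.β) ^ (i - p.iS) - (1 - p.γ) * (1 - p.β) ^ i) * F o
      - (if i < p.iS then 1 else 0) * F (had z o)
      - ((1 - p.β) ^ (i - p.iS) - (1 - p.β) ^ i
          - p.γ * p.β * (i - p.iS : ℕ) * (1 - p.β) ^ i) * F (psum z o)
      - 8 * p.ε * F o)
      = (∑ i ∈ Finset.range p.m, p.step * ((1 - p.step * p.γ) ^ (p.m - 1 - i)
          * ((1 - p.β) ^ (i - p.iS) - (1 - p.γ) * (1 - p.β) ^ i))) * F o
        - (∑ i ∈ Finset.range p.m, p.step * ((1 - p.step * p.γ) ^ (p.m - 1 - i)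
          * (if i < p.iS then 1 else 0))) * F (had z o)
        - (∑ i ∈ Finset.range p.m, p.step * ((1 - p.step * p.γ) ^ (p.m - 1 - i)
          * ((1 - p.β) ^ (i - p.iS) - (1 - p.β) ^ i
            - p.γ * p.β * (i - p.iS : ℕ) * (1 - p.β) ^ i))) * F (psum z o)
        - (∑ i ∈ Finset.range p.m, p.step * (1 - p.step * p.γ) ^ (p.m - 1 - i))
          * (8 * p.ε * F o) := by
    simp only [Finset.sum_mul]
    rw [← Finset.sum_sub_distrib, ← Finset.sum_sub_distrib, ← Finset.sum_sub_distrib]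
    exact Finset.sum_congr rfl fun i _ => by ring
  rw [hsplit] at hlow
  have hmin := hp.step_le_min
  have hδ := hmin.trans (min_le_left _ _)
  have hε := hmin.trans (min_le_right _ _)
  have hD := hF.diam_nonneg hP hz
  have hδD : p.step * (L * Metric.diam P ^ 2) / 2 ≤ p.δ * L * Metric.diam P ^ 2 := by
    have := mul_le_mul_of_nonneg_right hδ hD
    have := mul_nonneg h1.le hD
    linarith
  -- The constant is 61 = 8 + 11 + 4 + 38: surrogate errors, then the A, B and C discretizations,
  -- the last being 19γh F(z⊕o) ≤ 38h F(o).
  have hG' := mul_le_mul_of_nonneg_left hG (by linarith : 0 ≤ 19 * p.step)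
  have hodot' := mul_le_mul_of_nonneg_left hodot (by linarith : 0 ≤ 4 * p.step)
  have hεo := mul_le_mul_of_nonneg_right hε hFo
  linarith

end Params

end GammaFWG

/-! ### The two alternatives -/

theorem mainTheorem2 :
    ∃ C K : ℝ, 0 < C ∧ 0 < K ∧
      ∀ (n : ℕ) (F : Vec n → ℝ) (P : Set (Vec n)) (L : ℝ) (z o : Vec n) (p : Params),
        0 < p.γ → p.γ ≤ 1 →
        0 < p.tS → p.tS < 1 →
        0 < p.ε → p.ε < 1 / 2 →
        0 < p.δ → p.δ < 1 →
        (∀ x ∈ cube n, 0 ≤ F x) →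
        IsSmooth L F →
        IsWeaklyDR p.γ F →
        IsDownClosedBody P →
        z ∈ P →
        o ∈ P → IsMaxOn F P o →
        p.ValidSurrogates F z o →
        (p.m : ℝ) ≤ K * (p.δ⁻¹ + p.ε⁻¹) ∧
        (∃ x y : ℕ → Vec n, p.IsRun F P z x y) ∧
        ∀ x y : ℕ → Vec n, p.IsRun F P z x y →
          y p.m ∈ P ∧
          (∀ i, 1 ≤ i → i ≤ p.m → x i ∈ P) ∧
          ((coefA p.γ p.tS - C * p.ε) * F o + coefB p.γ p.tS * F (had z o)
                + coefC p.γ p.tS * F (psum z o) - p.δ * L * Metric.diam P ^ 2 ≤ F (y p.m) ∨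
            ∃ i, 1 ≤ i ∧ i ≤ p.m ∧
              F (psum (x i) o) ≤ F (psum z o) - p.ε * F o ∧
              ∃ y' ∈ p.Q F P z (i - 1) (y (i - 1)),
                IsMaxOn F (p.Q F P z (i - 1) (y (i - 1))) y' ∧
                (p.γ ^ 2 * F (vjoin (x i) o) + F (vmeet (x i) o)) / (1 + p.γ ^ 2)
                    - p.δ * p.γ / (1 + p.γ ^ 2) * (F y' + 1 / 2 * L * Metric.diam P ^ 2)
                  ≤ F (x i)) := by
  refine ⟨61, 2, by norm_num, by norm_num, ?_⟩
  intro n F P L z o p hγ0 hγ1 hT0 hT1 hε0 hε1 hδ0 hδ1 hF0 hF hdr hP hz ho hmax hv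
  have hp : p.Admissible := ⟨hγ0, hγ1, hT0, hT1, hε0, hε1, hδ0, hδ1⟩
  refine ⟨hp.m_le, Params.exists_isRun hp hP ho, fun x y hr => ⟨hr.output_mem hp hP hz,
    fun i hi1 him => ?_, ?_⟩⟩
  · obtain ⟨j, rfl⟩ := Nat.exists_eq_add_of_le' hi1
    exact hr.x_mem hP him
  -- The case distinction matches the hypothesis of `IsRun.mem_Q`; its negation supplies an
  -- iteration in which o is feasible and F(x(i+1)⊕o) is small.
  by_cases hlarge : ∀ i < p.m, o ∈ p.Q F P z i (y i) →
      F (psum z o) - p.ε * F o ≤ F (psum (x (i + 1)) o)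
  · exact Or.inl (hr.guarantee hp hF0 hF hdr hP hz ho hmax hv fun i hi =>
      ⟨o, hr.mem_Q hp hF0 hF.1 hdr hP hz ho hv hlarge hi⟩)
  · right
    push Not at hlarge
    obtain ⟨i, hi, hoQ, hlt⟩ := hlarge
    have hQc := Params.isCompact_Q (p := p) (F := F) (z := z) hP.compact i (y i)
    have hQP := Params.Q_subset (p := p) (F := F) (P := P) (z := z) i (y i)
    have hQconv := Params.convex_Q (p := p) (F := F) (z := z) hP.convex i (y i)
    have hm : 0 < p.m := by omega
    obtain ⟨y', hy', hy'max⟩ := hQc.exists_isMaxOn ⟨o, hoQ⟩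
      (hF.1.continuousOn.mono (hQP.trans hP.subset_cube))
    refine ⟨i + 1, by omega, hi, hlt.le, y', hy', hy'max, ?_⟩
    have hfw := hr.choose_x i hi ⟨o, hoQ⟩
    have hgap := hfw.inner_grad_le hP hQP hQconv hm hF hF0 hy'max hoQ
    have hxc := hP.subset_cube (hr.x_mem hP hi)
    refine le_trans ?_ (hdr.le_of_inner_grad_le hF.1 hγ0 hxc (hP.subset_cube ho) hgap)
    -- Nonnegativity of the bracket is what allows the gap factor 1/m to be enlarged to δ.
    have hpos : 0 ≤ F y' + 1 / 2 * L * Metric.diam P ^ 2 := by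
      have := hF0 _ (hP.subset_cube (hQP hy'))
      have := hF.diam_nonneg hP hz
      linarith
    have hstep : 1 / (p.m : ℝ) ≤ p.δ := hp.step_le_min.trans (min_le_left _ _)
    have h1 := mul_le_mul_of_nonneg_left (mul_le_mul_of_nonneg_right hstep hpos)
      (by positivity : 0 ≤ p.γ / (1 + p.γ ^ 2))
    have e : p.δ * p.γ / (1 + p.γ ^ 2) * (F y' + 1 / 2 * L * Metric.diam P ^ 2)
        = p.γ / (1 + p.γ ^ 2) * (p.δ * (F y' + 1 / 2 * L * Metric.diam P ^ 2)) := by ring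
    rw [e]
    linarith
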